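/- **Theorem 2 (bosonized elementary vertex operators).** Let $q=e^{\hbar}\in\mathbb C^\times$ be not a root of unity, $q^x=e^{x\hbar}$, $[x]=\frac{q^x-q^{-x}}{q-q^{-1}}$, let $\alpha\in\mathbb C\setminus\{0,-1\}$ with $[\alpha]\ne0$ and $[(\alpha+1)n]\neq 0$ for all $n\ge1$, and put $k=\alpha$. Fix square roots $\sqrt{[\alpha]},\sqrt{[\alpha+1]}$. Let $a^1_n,a^2_n,b^{12}_n,b^{13}_n,b^{23}_n,c_n$ $(n\in\mathbb Z)$, with $Q_{a^i},Q_{b^{ij}},Q_c$, be oscillators whose only nonzero commutators are $$[a^i_m,a^j_n]=\delta_{m+n,0}\tfrac{[a_{ij}m][(k+1)m]}{m},\quad [a^i_0,Q_{a^j}]=(k+1)a_{ij},\quad (a_{ij})=\begin{pmatrix}2&-1\\-1&0\end{pmatrix},$$ $$[x_m,x_n]=\epsilon_x\,\delta_{m+n,0}\tfrac{[m]^2}{m},\quad [x_0,Q_x]=\epsilon_x\qquad(x=b^{12},b^{13},b^{23},c;\ \epsilon_{b^{12}}=-1,\ \text{otherwise }\epsilon_x=1)$$ $(m,n\ne0)$,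 acting on the direct sum, over all $\mu\in\mathbb C^6$, of the Fock spaces generated by the creation operators over $e^{\mu\cdot Q}|0\rangle$. For any pair $(a_n,Q_a)$ put $$a(z;\kappa)=-\sum_{n\ne0}\tfrac{a_n}{[n]}q^{-\kappa|n|}z^{-n}+Q_a+a_0\ln z,\qquad a_\pm(z)=\pm(q-q^{-1})\sum_{n>0}a_{\pm n}z^{\mp n}\pm a_0\ln q .$$ Let (bosonized Drinfeld generators of $U_q[\widehat{sl(2|1)}]$ at level $k$), with $X^{\pm,i}(z)=\sum_n X^{\pm,i}_nz^{-n-1}$, $$h^1_m= a^1_mq^{-\frac{|m|}{2}}+b^{12}_mq^{-(\frac k2+1)|m|}(q^{|m|}+q^{-|m|})+b^{13}_mq^{-(\frac k2+2)|m|}-b^{23}_mq^{-(\frac k2+1)|m|},$$ $$h^2_m=a^2_mq^{-\frac{|m|}{2}}-b^{12}_mq^{-(\frac k2+1)|m|}-b^{13}_mq^{-(\frac k2+1)|m|},$$ $$X^{+,1}(z)=-\tfrac{1}{(q-q^{-1})z}:e^{-b^{12}(z;-1)}(e^{-c(qz;0)}-e^{-c(q^{-1}z;0)}):e^{\sqrt{-1}\pi(c_0+b^{12}_0)},$$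 $$X^{+,2}(z)=-:e^{-b^{12}_+(qz)-b^{13}_+(qz)+b^{23}(qz;0)}:e^{\sqrt{-1}\pi(c_0+b^{12}_0+b^{13}_0+b^{23}_0)}+:e^{b^{12}(z;0)+b^{13}(z;0)+c(z;0)}:,$$ $$X^{-,1}(z)=\tfrac{1}{(q-q^{-1})z}:\Big(e^{a^1_+(q^{\frac{k+1}2}z)+b^{12}(q^{k+2}z;1)+b^{13}_+(q^{k+2}z)-b^{23}_+(q^{k+1}z)+c(q^{k+1}z;0)}$$ $$-e^{a^1_-(q^{-\frac{k+1}2}z)+b^{12}(q^{-k-2}z;1)+b^{13}_-(q^{-k-2}z)-b^{23}_-(q^{-k-1}z)+c(q^{-k-1}z;0)}\Big):e^{-\sqrt{-1}\pi(c_0+b^{12}_0)}$$ $$+q^{k+1}:e^{a^1_+(q^{\frac{k+1}2}z)-b^{13}(q^{k+1}z;0)+b^{23}(q^{k+1}z;-1)}:e^{\sqrt{-1}\pi(b^{13}_0+b^{23}_0)},$$ $$X^{-,2}(z)=\tfrac{1}{(q-q^{-1})z}\Big(q:\big(e^{a^2_+(q^{\frac{k+1}2}z)-b^{23}(q^{k+1}z;0)}-e^{a^2_-(q^{-\frac{k+1}2}z)-b^{23}(q^{-k-1}z;0)}\big):e^{-\sqrt{-1}\pi(c_0+b^{12}_0+b^{13}_0+b^{23}_0)}$$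 $$-:e^{a^2_-(q^{-\frac{k+1}2}z)-b^{12}(q^{-k-1}z;1)-b^{13}(q^{-k-1}z;1)}\big(e^{-c(q^{-k}z;0)}-e^{-c(q^{-k-2}z;0)}\big):\Big).$$ Let (ratios at $m=0$ being the limits $2$ and $\frac{\alpha}{\alpha+1}$) $D_m=a^1_m+\frac{[2m]}{[m]}a^2_m$, $Q_D=Q_{a^1}+2Q_{a^2}$ and $$A^*_m=-D_mq^{\frac{|m|}2},\qquad B^*_m=-\tfrac{[\alpha m]}{[(\alpha+1)m]}D_mq^{\frac{|m|}2},$$ $$\tilde B^*_m=-D_mq^{-\frac{|m|}2}+(b^{13}_m+q^{-|m|}b^{23}_m)q^{-\frac\alpha2|m|},\qquad \tilde A^*_m=-\tfrac{[\alpha m]}{[(\alpha+1)m]}D_mq^{-\frac{|m|}2}-(q^{|m|}b^{13}_m+b^{23}_m)q^{\frac{3\alpha}2|m|},$$ $$Q_{A^*}=-Q_D,\quad Q_{B^*}=-\tfrac{\alpha}{\alpha+1}Q_D,\quad Q_{\tilde B^*}=-Q_D+Q_{b^{13}}+Q_{b^{23}},\quad Q_{\tilde A^*}=-\tfrac{\alpha}{\alpha+1}Q_D-Q_{b^{13}}-Q_{b^{23}}.$$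 Define $$\phi_4(z)=:e^{-A^*(q^{\alpha+1}z;-\frac\alpha2)}:,\qquad \phi^*_1(z)=:e^{B^*(q^{\alpha}z;-\frac\alpha2)}:,$$ $$\psi_1(z)=:e^{-\tilde B^*(q^{\alpha}z;\frac\alpha2)}:e^{\sqrt{-1}\pi(b^{13}_0+b^{23}_0)},\qquad \psi^*_4(z)=:e^{\tilde A^*(q^{\alpha-1}z;\frac\alpha2)}:e^{\sqrt{-1}\pi(b^{13}_0+b^{23}_0)}.$$ Then, as identities of operator-valued formal series: 1. $[\phi_4(z),X^{+,i}(w)]=[\phi^*_1(z),X^{+,i}(w)]=0$ and $[\psi_1(z),X^{-,i}(w)]=[\psi^*_4(z),X^{-,i}(w)]=0$ (commutators) for $i=1,2$. 2. For $n>0$, each $\Theta\in\{\phi_4,\phi_1^*,\psi_1,\psi_4^*\}$ satisfies $q^{h^i_0}\Theta(z)q^{-h^i_0}=q^{w\delta_{i2}}\Theta(z)$, $[h^i_n,\Theta(z)]=\delta_{i2}q^{un}\frac{[wn]}{n}z^n\Theta(z)$, $[h^i_{-n},\Theta(z)]=\delta_{i2}q^{vn}\frac{[wn]}{n}z^{-n}\Theta(z)$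 with $(w,u,v)$ equal to $(-\alpha-1,\,1+\frac32\alpha,\,-1-\frac12\alpha)$ for $\phi_4$; $(\alpha,\,\frac32\alpha,\,-\frac12\alpha)$ for $\phi^*_1$; $(-\alpha,\,\frac12\alpha,\,-\frac32\alpha)$ for $\psi_1$; $(\alpha+1,\,\frac12\alpha-1,\,1-\frac32\alpha)$ for $\psi^*_4$. 3. The remaining components are uniquely determined by the following formulas, where components $1,4$ are even and $2,3$ odd, $[X,Y]_\xi=XY-(-1)^{[X][Y]}\xi YX$, and $e_i=\oint\frac{dw}{2\pi\sqrt{-1}}X^{+,i}(w)$, $f_i=\oint\frac{dw}{2\pi\sqrt{-1}}X^{-,i}(w)$ ($i=1$ even, $i=2$ odd): $$\phi_3=-\tfrac{1}{\sqrt{[\alpha+1]}}[\phi_4,f_2]_{q^{-\alpha-1}},\quad \phi_2=[\phi_3,f_1]_q,\quad \phi_1=-\tfrac1{\sqrt{[\alpha]}}[\phi_2,f_2]_{q^{-\alpha}},$$ $$\phi^*_2=\tfrac{q^{-\alpha}}{\sqrt{[\alpha]}}[\phi^*_1,f_2]_{q^\alpha},\quad \phi^*_3=-q^{-1}[\phi^*_2,f_1]_q,\quad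 \phi^*_4=-\tfrac{q^{-\alpha-1}}{\sqrt{[\alpha+1]}}[\phi^*_3,f_2]_{q^{\alpha+1}},$$ $$\psi_2=\tfrac1{\sqrt{[\alpha]}}[\psi_1,e_2]_{q^\alpha},\quad \psi_3=[\psi_2,e_1]_q,\quad \psi_4=\tfrac1{\sqrt{[\alpha+1]}}[\psi_3,e_2]_{q^{\alpha+1}},$$ $$\psi^*_3=-\tfrac{q^{\alpha+1}}{\sqrt{[\alpha+1]}}[\psi^*_4,e_2]_{q^{-\alpha-1}},\quad \psi^*_2=-q[\psi^*_3,e_1]_q,\quad \psi^*_1=\tfrac{q^\alpha}{\sqrt{[\alpha]}}[\psi^*_2,e_2]_{q^{-\alpha}}.$$ 4. Without its sign factor, the exponential $:e^{-\tilde B^*(q^\alpha z;\frac\alpha2)}:$ satisfies the same relations as $\psi_1$, except that it anticommutes, instead of commuting, with $X^{-,2}(w)$. -/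

import Mathlib

open scoped Nat

noncomputable section

namespace QVertex

/-! ### q-numbers

The deformation parameter is `q = exp ℏ`; fixing the logarithm `ℏ` fixes all complex powers
`q ^ x = exp (x ℏ)`. -/

/-- `q ^ x` for a complex exponent `x`. -/
def qpow (ℏ x : ℂ) : ℂ := Complex.exp (x * ℏ)

/-- `[x]_q = (q ^ x - q ^ (-x)) / (q - q⁻¹)`. -/
def qnum (ℏ x : ℂ) : ℂ := (qpow ℏ x - qpow ℏ (-x)) / (qpow ℏ 1 - qpow ℏ (-1))

/-! ### Oscillators and the bosonic Fock space -/

/-- The six free bosons `a¹, a², b¹², b¹³, b²³, c`. -/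
inductive Boson where
  | a1 | a2 | b12 | b13 | b23 | c
  deriving DecidableEq

open Boson

instance : Fintype Boson where
  elems := {a1, a2, b12, b13, b23, c}
  complete i := by cases i <;> decide

/-- `oscComm ℏ k i j n` is the scalar `[i_n, j_{-n}]` for `n ≠ 0`. -/
def oscComm (ℏ k : ℂ) : Boson → Boson → ℤ → ℂ
  | a1, a1, n => qnum ℏ (2 * n) * qnum ℏ ((k + 1) * n) / n
  | a1, a2, n => qnum ℏ (-n) * qnum ℏ ((k + 1) * n) / n
  | a2, a1, n => qnum ℏ (-n) * qnum ℏ ((k + 1) * n) / n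
  | b12, b12, n => -(qnum ℏ n ^ 2 / n)
  | b13, b13, n => qnum ℏ n ^ 2 / n
  | b23, b23, n => qnum ℏ n ^ 2 / n
  | c, c, n => qnum ℏ n ^ 2 / n
  | _, _, _ => 0

/-- `zeroComm k i j` is the scalar `[i_0, Q_j]`. -/
def zeroComm (k : ℂ) : Boson → Boson → ℂ
  | a1, a1 => 2 * (k + 1)
  | a1, a2 => -(k + 1)
  | a2, a1 => -(k + 1)
  | b12, b12 => -1
  | b13, b13 => 1
  | b23, b23 => 1
  | c, c => 1
  | _, _ => 0

/-- Polynomials in the creation operators: the variable `(i, n)` is `i_{-n}`, `n ≥ 1`. -/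
abbrev Pol : Type := MvPolynomial (Boson × ℕ+) ℂ

/-- A charge vector `μ`, standing for the exponent `∑ i, μ i • Q_i`. -/
abbrev Charge : Type := Boson → ℂ

/-- The bosonic Fock space, the direct sum over all `μ ∈ ℂ⁶` of the spaces generated by the
creation operators over the vector `exp (∑ i, μ i • Q_i) |0⟩`. -/
abbrev Fock : Type := Charge →₀ Pol

/-- The eigenvalue of the zero mode `i_0` on the sector of charge `μ`. -/
def zeroEig (k : ℂ) (i : Boson) (μ : Charge) : ℂ := ∑ j, zeroComm k i j * μ j

/-- The annihilation operator `i_n`, `n ≥ 1`, inside one sector. -/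
def annihPol (ℏ k : ℂ) (i : Boson) (n : ℕ+) : Module.End ℂ Pol :=
  ∑ j, oscComm ℏ k i j n • (MvPolynomial.pderiv (j, n)).toLinearMap

/-- The same operator on polynomials applied in every sector. -/
def inSectors (T : Module.End ℂ Pol) : Module.End ℂ Fock := Finsupp.mapRange.linearMap T

/-- The operator that acts on the sector of charge `μ` as the scalar `f μ`. -/
def diagOp (f : Charge → ℂ) : Module.End ℂ Fock :=
  Finsupp.lsum ℂ fun μ => f μ • Finsupp.lsingle μ

/-- The oscillator `i_n` (`n ∈ ℤ`) as an operator on the Fock space. -/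
def osc (ℏ k : ℂ) (i : Boson) (n : ℤ) : Module.End ℂ Fock :=
  if h : 0 < n then inSectors (annihPol ℏ k i ⟨n.toNat, by omega⟩)
  else if h' : n < 0 then
    inSectors (LinearMap.mulLeft ℂ (MvPolynomial.X (i, ⟨(-n).toNat, by omega⟩)))
  else diagOp (zeroEig k i)

/-! ### Exponents -/

/-- A formal linear expression
`∑_{n ≠ 0} ∑_i coef i n • i_n z^{-n} + ∑_i charge i • Q_i + ∑_i (zlog i * ln z + zconst i) • i_0`.
The value of `coef` at `n = 0` is not used. -/
@[ext]
structure Exponent where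
  coef : Boson → ℤ → ℂ
  charge : Boson → ℂ
  zlog : Boson → ℂ
  zconst : Boson → ℂ

instance : Add Exponent :=
  ⟨fun E F => ⟨E.coef + F.coef, E.charge + F.charge, E.zlog + F.zlog, E.zconst + F.zconst⟩⟩

instance : Neg Exponent := ⟨fun E => ⟨-E.coef, -E.charge, -E.zlog, -E.zconst⟩⟩

instance : Sub Exponent := ⟨fun E F => E + -F⟩

/-- A combination of bosons: the oscillators `A_m = ∑_i coef i m • i_m` (all `m ∈ ℤ`) together
with `Q_A = ∑_i charge i • Q_i`. -/
structure Combination where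
  coef : Boson → ℤ → ℂ
  charge : Boson → ℂ

/-- A single boson `i`, seen as a combination. -/
def single (i : Boson) : Combination :=
  ⟨fun j _ => if j = i then 1 else 0, fun j => if j = i then 1 else 0⟩

/-- `A(q^x z; κ) = -∑_{n ≠ 0} A_n / [n]_q q^{-κ|n|} (q^x z)^{-n} + Q_A + A_0 ln (q^x z)`. -/
def field (ℏ : ℂ) (A : Combination) (x κ : ℂ) : Exponent where
  coef i n := -(A.coef i n / qnum ℏ n) * qpow ℏ (-κ * (|n| : ℤ)) * qpow ℏ (-x * n)
  charge := A.charge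
  zlog i := A.coef i 0
  zconst i := x * ℏ * A.coef i 0

/-- `i(q^x z; κ)` for a single boson `i`. -/
def fld (ℏ : ℂ) (i : Boson) (x κ : ℂ) : Exponent := field ℏ (single i) x κ

/-- `i_+(q^x z) = (q - q⁻¹) ∑_{n > 0} i_n (q^x z)^{-n} + i_0 ln q`. -/
def plus (ℏ : ℂ) (i : Boson) (x : ℂ) : Exponent where
  coef j n := if j = i ∧ 0 < n then (qpow ℏ 1 - qpow ℏ (-1)) * qpow ℏ (-x * n) else 0
  charge := 0
  zlog := 0
  zconst j := if j = i then ℏ else 0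

/-- `i_-(q^x z) = -(q - q⁻¹) ∑_{n > 0} i_{-n} (q^x z)^n - i_0 ln q`. -/
def minus (ℏ : ℂ) (i : Boson) (x : ℂ) : Exponent where
  coef j n := if j = i ∧ n < 0 then -(qpow ℏ 1 - qpow ℏ (-1)) * qpow ℏ (-x * n) else 0
  charge := 0
  zlog := 0
  zconst j := if j = i then -ℏ else 0

/-! ### Normal-ordered exponentials -/

/-- The coefficient of `t^N` in `exp (∑_{n ≥ 1} T n t^n)`. -/
def expCoeff {A : Type*} [Ring A] [Algebra ℂ A] (T : ℕ+ → A) (N : ℕ) : A :=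
  ∑ j ∈ Finset.range (N + 1),
    ((j ! : ℂ)⁻¹) • PowerSeries.coeff N
      ((PowerSeries.mk fun n => if h : 0 < n then T ⟨n, h⟩ else 0) ^ j)

/-- The coefficient of `z^N` in the exponential of the creation part of `E`. -/
def createCoeff (E : Exponent) (N : ℕ) : Pol :=
  expCoeff (fun n : ℕ+ => ∑ i, E.coef i (-(n : ℤ)) • (MvPolynomial.X (i, n) : Pol)) N

/-- The coefficient of `z^{-r}` in the exponential of the annihilation part of `E`. -/
def annihCoeff (ℏ k : ℂ) (E : Exponent) (r : ℕ) : Module.End ℂ Pol :=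
  expCoeff (fun n : ℕ+ => ∑ i, E.coef i n • annihPol ℏ k i n) r

/-- The energy `∑ n` of a monomial in the creation operators. -/
def energy (m : Boson × ℕ+ →₀ ℕ) : ℕ := m.sum fun v e => e * (v.2 : ℕ)

/-- Polynomials all of whose monomials have energy less than `w`. -/
def below (w : ℕ) : Submodule ℂ Pol := MvPolynomial.restrictSupport ℂ {m | energy m < w}

theorem annihPol_mem (ℏ k : ℂ) (i : Boson) (n : ℕ+) (w : ℕ) {P : Pol} (hP : P ∈ below w) :
    annihPol ℏ k i n P ∈ below (w - n) := by
  classical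
  simp only [annihPol, LinearMap.sum_apply, LinearMap.smul_apply]
  refine Submodule.sum_mem _ fun j _ => Submodule.smul_mem _ _ ?_
  unfold below at hP
  rw [MvPolynomial.restrictSupport_eq_span] at hP
  change (MvPolynomial.pderiv (j, n)).toLinearMap P ∈ below (w - n)
  refine Submodule.span_induction (p := fun P _ =>
    (MvPolynomial.pderiv (j, n)).toLinearMap P ∈ below (w - n)) ?_ ?_ ?_ ?_ hP
  · rintro _ ⟨m, hm, rfl⟩
    simp only [Derivation.coeFn_coe, MvPolynomial.pderiv_monomial, one_mul]
    by_cases h0 : m (j, n) = 0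
    · simp [h0]
    · refine (MvPolynomial.monomial_mem_restrictSupport ℂ).2 (Or.inl ?_)
      have hle : Finsupp.single (j, n) 1 ≤ m := by
        rw [Finsupp.single_le_iff]; omega
      have hs : energy m = energy (m - Finsupp.single (j, n) 1) + n := by
        conv_lhs => rw [← tsub_add_cancel_of_le hle]
        unfold energy
        rw [Finsupp.sum_add_index' (by simp) (by intros; ring), Finsupp.sum_single_index (by simp)]
        simp
      simp only [Set.mem_ofPred_eq] at hm ⊢
      omega
  · simp
  · intro x y _ _ hx hy
    rw [map_add]; exact Submodule.add_mem _ hx hy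
  · intro a x _ hx
    rw [map_smul]; exact Submodule.smul_mem _ _ hx

theorem coeff_pow_mem (T : ℕ+ → Module.End ℂ Pol)
    (hT : ∀ (n : ℕ+) (w : ℕ) (P : Pol), P ∈ below w → T n P ∈ below (w - n)) (j : ℕ) :
    ∀ (r w : ℕ) (P : Pol), P ∈ below w →
      PowerSeries.coeff r ((PowerSeries.mk fun n => if h : 0 < n then T ⟨n, h⟩ else 0) ^ j) P
        ∈ below (w - r) := by
  induction j with
  | zero =>
    intro r w P hP
    rw [pow_zero, PowerSeries.coeff_one]
    split_ifs with h
    · subst h; simpa using hP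
    · simp
  | succ j ih =>
    intro r w P hP
    rw [pow_succ, PowerSeries.coeff_mul, LinearMap.sum_apply]
    refine Submodule.sum_mem _ fun x hx => ?_
    replace hx : x.1 + x.2 = r := by simpa using hx
    rw [Module.End.mul_apply, PowerSeries.coeff_mk]
    split_ifs with h
    · have h1 := ih x.1 (w - x.2) _ (hT ⟨x.2, h⟩ w P hP)
      have h2 : w - x.2 - x.1 = w - r := by omega
      rwa [h2] at h1
    · simp

theorem expCoeff_mem (T : ℕ+ → Module.End ℂ Pol)
    (hT : ∀ (n : ℕ+) (w : ℕ) (P : Pol), P ∈ below w → T n P ∈ below (w - n))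
    (r w : ℕ) (P : Pol) (hP : P ∈ below w) : expCoeff T r P ∈ below (w - r) := by
  unfold expCoeff
  rw [LinearMap.sum_apply]
  refine Submodule.sum_mem _ fun j _ => ?_
  exact Submodule.smul_mem _ _ (coeff_pow_mem T hT j r w P hP)

theorem annihCoeff_mem (ℏ k : ℂ) (E : Exponent) (r w : ℕ) (P : Pol) (hP : P ∈ below w) :
    annihCoeff ℏ k E r P ∈ below (w - r) := by
  refine expCoeff_mem _ (fun n w P hP => ?_) r w P hP
  rw [LinearMap.sum_apply]
  refine Submodule.sum_mem _ fun i _ => ?_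
  rw [LinearMap.smul_apply]
  exact Submodule.smul_mem _ _ (annihPol_mem ℏ k i n w hP)

theorem exists_mem_below (P : Pol) : ∃ w, P ∈ below w := by
  refine ⟨P.support.sup energy + 1, ?_⟩
  unfold below
  rw [MvPolynomial.mem_restrictSupport_iff]
  intro m hm
  exact Nat.lt_succ_of_le (Finset.le_sup (f := energy) hm)

theorem annihCoeff_eq_zero (ℏ k : ℂ) (E : Exponent) (P : Pol) :
    ∃ w, ∀ r, w ≤ r → annihCoeff ℏ k E r P = 0 := by
  obtain ⟨w, hw⟩ := exists_mem_below P
  refine ⟨w, fun r hr => ?_⟩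
  have h := annihCoeff_mem ℏ k E r w P hw
  rw [Nat.sub_eq_zero_of_le hr] at h
  unfold below at h
  rw [MvPolynomial.mem_restrictSupport_iff] at h
  rw [← MvPolynomial.support_eq_empty, Finset.eq_empty_iff_forall_notMem]
  intro m hm
  exact absurd (h hm) (by simp)

theorem oscCoeff_finite (ℏ k : ℂ) (E : Exponent) (d : ℤ) (P : Pol) :
    (Function.support fun r : ℕ =>
      if 0 ≤ d + r then createCoeff E (d + r).toNat * annihCoeff ℏ k E r P else 0).Finite := by
  obtain ⟨w, hw⟩ := annihCoeff_eq_zero ℏ k E P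
  refine (Set.finite_lt_nat w).subset fun r hr => ?_
  by_contra h
  exact hr (by simp [hw r (not_lt.1 h)])

/-- The coefficient of `z^d` (`d ∈ ℤ`) in the product of the exponential of the creation part
and the exponential of the annihilation part of `E`. The sum over the number `r` of annihilated
quanta has only finitely many nonzero terms on each vector. -/
def oscCoeff (ℏ k : ℂ) (E : Exponent) (d : ℤ) : Module.End ℂ Pol where
  toFun P := ∑ᶠ r : ℕ, if 0 ≤ d + r then createCoeff E (d + r).toNat * annihCoeff ℏ k E r P else 0
  map_add' P Q := by
    rw [← finsum_add_distrib (oscCoeff_finite ℏ k E d P) (oscCoeff_finite ℏ k E d Q)]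
    refine finsum_congr fun r => ?_
    split_ifs <;> simp [mul_add]
  map_smul' c P := by
    rw [RingHom.id_apply, smul_finsum' c (oscCoeff_finite ℏ k E d P)]
    refine finsum_congr fun r => ?_
    split_ifs <;> simp

/-- Operator-valued formal series `∑_{s ∈ ℂ} F s z^s` in complex powers of `z`. -/
abbrev Series : Type := ℂ → Module.End ℂ Fock

open Classical in
/-- The normal-ordered exponential `:e^{E}:`, all creation operators and all `Q_i` to the left of
the annihilation operators and the `i_0`: on the sector of charge `μ`, the zero modes give
`e^{zconst} z^{zlog}`, the oscillators give integral powers of `z`, and the charge is shifted. -/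
def normalExp (ℏ k : ℂ) (E : Exponent) : Series := fun s =>
  Finsupp.lsum ℂ fun μ =>
    let x : ℂ := s - ∑ i, E.zlog i * zeroEig k i μ
    Complex.exp (∑ i, E.zconst i * zeroEig k i μ) •
      (Finsupp.lsingle (μ + E.charge) ∘ₗ
        (if x = (⌊x.re⌋ : ℂ) then oscCoeff ℏ k E ⌊x.re⌋ else 0))

/-- `z^m F(z)`. -/
def zmul (m : ℂ) (F : Series) : Series := fun s => F (s - m)

/-- `F(z) T` for an operator `T` independent of `z`. -/
def rmul (F : Series) (T : Module.End ℂ Fock) : Series := fun s => F s * T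

/-- `exp (√-1 π ∑_{i ∈ L} i_0)`. -/
def signOp (k : ℂ) (L : Finset Boson) : Module.End ℂ Fock :=
  diagOp fun μ => Complex.exp (Complex.I * Real.pi * ∑ i ∈ L, zeroEig k i μ)

/-- `exp (-√-1 π ∑_{i ∈ L} i_0)`. -/
def signOpInv (k : ℂ) (L : Finset Boson) : Module.End ℂ Fock :=
  diagOp fun μ => Complex.exp (-(Complex.I * Real.pi * ∑ i ∈ L, zeroEig k i μ))

/-! ### Bosonized Drinfeld generators of `U_q[sl(2|1)^]` at level `k` -/

/-- `h¹_m`, `m ∈ ℤ`. -/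
def h1 (ℏ k : ℂ) (m : ℤ) : Module.End ℂ Fock :=
  let M : ℂ := (|m| : ℤ)
  qpow ℏ (-M / 2) • osc ℏ k a1 m
    + (qpow ℏ (-(k / 2 + 1) * M) * (qpow ℏ M + qpow ℏ (-M))) • osc ℏ k b12 m
    + qpow ℏ (-(k / 2 + 2) * M) • osc ℏ k b13 m
    - qpow ℏ (-(k / 2 + 1) * M) • osc ℏ k b23 m

/-- `h²_m`, `m ∈ ℤ`. -/
def h2 (ℏ k : ℂ) (m : ℤ) : Module.End ℂ Fock :=
  let M : ℂ := (|m| : ℤ)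
  qpow ℏ (-M / 2) • osc ℏ k a2 m
    - qpow ℏ (-(k / 2 + 1) * M) • osc ℏ k b12 m
    - qpow ℏ (-(k / 2 + 1) * M) • osc ℏ k b13 m

/-- `q^{x h¹_0}` with `h¹_0 = a¹_0 + 2 b¹²_0 + b¹³_0 - b²³_0`. -/
def qh1 (ℏ k x : ℂ) : Module.End ℂ Fock :=
  diagOp fun μ => qpow ℏ (x * (zeroEig k a1 μ + 2 * zeroEig k b12 μ + zeroEig k b13 μ
    - zeroEig k b23 μ))

/-- `q^{x h²_0}` with `h²_0 = a²_0 - b¹²_0 - b¹³_0`. -/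
def qh2 (ℏ k x : ℂ) : Module.End ℂ Fock :=
  diagOp fun μ => qpow ℏ (x * (zeroEig k a2 μ - zeroEig k b12 μ - zeroEig k b13 μ))

/-- The current `X^{+,1}(z)`. -/
def Xp1 (ℏ k : ℂ) : Series :=
  (-(qpow ℏ 1 - qpow ℏ (-1))⁻¹) • zmul (-1) (rmul
    (normalExp ℏ k (-fld ℏ b12 0 (-1) - fld ℏ c 1 0)
      - normalExp ℏ k (-fld ℏ b12 0 (-1) - fld ℏ c (-1) 0))
    (signOp k {c, b12}))

/-- The current `X^{+,2}(z)`. -/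
def Xp2 (ℏ k : ℂ) : Series :=
  -rmul (normalExp ℏ k (-plus ℏ b12 1 - plus ℏ b13 1 + fld ℏ b23 1 0))
      (signOp k {c, b12, b13, b23})
    + normalExp ℏ k (fld ℏ b12 0 0 + fld ℏ b13 0 0 + fld ℏ c 0 0)

/-- The current `X^{-,1}(z)`. -/
def Xm1 (ℏ k : ℂ) : Series :=
  (qpow ℏ 1 - qpow ℏ (-1))⁻¹ • zmul (-1) (rmul
    (normalExp ℏ k (plus ℏ a1 ((k + 1) / 2) + fld ℏ b12 (k + 2) 1 + plus ℏ b13 (k + 2)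
        - plus ℏ b23 (k + 1) + fld ℏ c (k + 1) 0)
      - normalExp ℏ k (minus ℏ a1 (-(k + 1) / 2) + fld ℏ b12 (-k - 2) 1 + minus ℏ b13 (-k - 2)
        - minus ℏ b23 (-k - 1) + fld ℏ c (-k - 1) 0))
    (signOpInv k {c, b12}))
  + qpow ℏ (k + 1) • rmul
    (normalExp ℏ k (plus ℏ a1 ((k + 1) / 2) - fld ℏ b13 (k + 1) 0 + fld ℏ b23 (k + 1) (-1)))
    (signOp k {b13, b23})

/-- The current `X^{-,2}(z)`. -/
def Xm2 (ℏ k : ℂ) : Series :=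
  (qpow ℏ 1 - qpow ℏ (-1))⁻¹ • zmul (-1)
    (qpow ℏ 1 • rmul
      (normalExp ℏ k (plus ℏ a2 ((k + 1) / 2) - fld ℏ b23 (k + 1) 0)
        - normalExp ℏ k (minus ℏ a2 (-(k + 1) / 2) - fld ℏ b23 (-k - 1) 0))
      (signOpInv k {c, b12, b13, b23})
    - (normalExp ℏ k (minus ℏ a2 (-(k + 1) / 2) - fld ℏ b12 (-k - 1) 1 - fld ℏ b13 (-k - 1) 1
          - fld ℏ c (-k) 0)
        - normalExp ℏ k (minus ℏ a2 (-(k + 1) / 2) - fld ℏ b12 (-k - 1) 1 - fld ℏ b13 (-k - 1) 1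
          - fld ℏ c (-k - 2) 0)))

/-! ### The oscillator combinations `A*, B*, B̃*, Ã*` -/

/-- `[2m]_q / [m]_q`, with its limit `2` at `m = 0`. -/
def ratioTwo (ℏ : ℂ) (m : ℤ) : ℂ := if m = 0 then 2 else qnum ℏ (2 * m) / qnum ℏ m

/-- `[α m]_q / [(α + 1) m]_q`, with its limit `α / (α + 1)` at `m = 0`. -/
def ratioAlpha (ℏ α : ℂ) (m : ℤ) : ℂ :=
  if m = 0 then α / (α + 1) else qnum ℏ (α * m) / qnum ℏ ((α + 1) * m)

/-- `A*_m = -(a¹_m + [2m]/[m] a²_m) q^{|m|/2}`. -/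
def Astar (ℏ : ℂ) : Combination where
  coef i m := match i with
    | a1 => -qpow ℏ ((|m| : ℤ) / 2)
    | a2 => -(ratioTwo ℏ m * qpow ℏ ((|m| : ℤ) / 2))
    | _ => 0
  charge i := match i with
    | a1 => -1
    | a2 => -2
    | _ => 0

/-- `B*_m = -[αm]/[(α+1)m] (a¹_m + [2m]/[m] a²_m) q^{|m|/2}`. -/
def Bstar (ℏ α : ℂ) : Combination where
  coef i m := match i with
    | a1 => -(ratioAlpha ℏ α m * qpow ℏ ((|m| : ℤ) / 2))
    | a2 => -(ratioAlpha ℏ α m * ratioTwo ℏ m * qpow ℏ ((|m| : ℤ) / 2))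
    | _ => 0
  charge i := match i with
    | a1 => -(α / (α + 1))
    | a2 => -(2 * (α / (α + 1)))
    | _ => 0

/-- `B̃*_m = -(a¹_m + [2m]/[m] a²_m) q^{-|m|/2} + (b¹³_m + q^{-|m|} b²³_m) q^{-α|m|/2}`. -/
def BtildeStar (ℏ α : ℂ) : Combination where
  coef i m := match i with
    | a1 => -qpow ℏ (-(|m| : ℤ) / 2)
    | a2 => -(ratioTwo ℏ m * qpow ℏ (-(|m| : ℤ) / 2))
    | b13 => qpow ℏ (-(α / 2) * (|m| : ℤ))
    | b23 => qpow ℏ (-(|m| : ℤ)) * qpow ℏ (-(α / 2) * (|m| : ℤ))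
    | _ => 0
  charge i := match i with
    | a1 => -1
    | a2 => -2
    | b13 => 1
    | b23 => 1
    | _ => 0

/-- `Ã*_m = -[αm]/[(α+1)m] (a¹_m + [2m]/[m] a²_m) q^{-|m|/2}
  - (q^{|m|} b¹³_m + b²³_m) q^{3α|m|/2}`. -/
def AtildeStar (ℏ α : ℂ) : Combination where
  coef i m := match i with
    | a1 => -(ratioAlpha ℏ α m * qpow ℏ (-(|m| : ℤ) / 2))
    | a2 => -(ratioAlpha ℏ α m * ratioTwo ℏ m * qpow ℏ (-(|m| : ℤ) / 2))
    | b13 => -(qpow ℏ (|m| : ℤ) * qpow ℏ (3 * α / 2 * (|m| : ℤ)))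
    | b23 => -qpow ℏ (3 * α / 2 * (|m| : ℤ))
    | _ => 0
  charge i := match i with
    | a1 => -(α / (α + 1))
    | a2 => -(2 * (α / (α + 1)))
    | b13 => -1
    | b23 => -1
    | _ => 0

/-! ### The elementary vertex operators, at level `k = α` -/

/-- `φ₄(z) = :exp(-A*(q^{α+1} z; -α/2)):`. -/
def phi4 (ℏ α : ℂ) : Series := normalExp ℏ α (-field ℏ (Astar ℏ) (α + 1) (-α / 2))

/-- `φ*₁(z) = :exp(B*(q^α z; -α/2)):`. -/
def phiStar1 (ℏ α : ℂ) : Series := normalExp ℏ α (field ℏ (Bstar ℏ α) α (-α / 2))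

/-- `:exp(-B̃*(q^α z; α/2)):`, without a sign factor. -/
def psi1Bare (ℏ α : ℂ) : Series := normalExp ℏ α (-field ℏ (BtildeStar ℏ α) α (α / 2))

/-- `ψ₁(z) = :exp(-B̃*(q^α z; α/2)): exp(√-1 π (b¹³_0 + b²³_0))`. -/
def psi1 (ℏ α : ℂ) : Series := rmul (psi1Bare ℏ α) (signOp α {b13, b23})

/-- `ψ*₄(z) = :exp(Ã*(q^{α-1} z; α/2)): exp(√-1 π (b¹³_0 + b²³_0))`. -/
def psiStar4 (ℏ α : ℂ) : Series :=
  rmul (normalExp ℏ α (field ℏ (AtildeStar ℏ α) (α - 1) (α / 2))) (signOp α {b13, b23})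

/-! ### Relations and recursion -/

/-- `F(z) G(w) = G(w) F(z)` as formal series in `z` and `w`. -/
def Commute₂ (F G : Series) : Prop := ∀ s t : ℂ, F s * G t = G t * F s

/-- `F(z) G(w) = -G(w) F(z)` as formal series in `z` and `w`. -/
def Anticommute₂ (F G : Series) : Prop := ∀ s t : ℂ, F s * G t = -(G t * F s)

/-- The relations of `Θ(z)` with the Cartan generators of level `k`: weight zero under `h¹`,
weight `w` under `h²`, and for all `n > 0`
`[h¹_{±n}, Θ(z)] = 0`, `[h²_n, Θ(z)] = q^{u n} [w n]_q / n z^n Θ(z)`,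
`[h²_{-n}, Θ(z)] = q^{v n} [w n]_q / n z^{-n} Θ(z)`. -/
structure CartanRelations (ℏ k w u v : ℂ) (Θ : Series) : Prop where
  weight_one : ∀ s, qh1 ℏ k 1 * Θ s * qh1 ℏ k (-1) = Θ s
  weight_two : ∀ s, qh2 ℏ k 1 * Θ s * qh2 ℏ k (-1) = qpow ℏ w • Θ s
  h1_pos : ∀ n : ℕ, 0 < n → ∀ s, h1 ℏ k n * Θ s - Θ s * h1 ℏ k n = 0
  h1_neg : ∀ n : ℕ, 0 < n → ∀ s, h1 ℏ k (-n) * Θ s - Θ s * h1 ℏ k (-n) = 0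
  h2_pos : ∀ n : ℕ, 0 < n → ∀ s, h2 ℏ k n * Θ s - Θ s * h2 ℏ k n
    = (qpow ℏ (u * n) * (qnum ℏ (w * n) / n)) • zmul n Θ s
  h2_neg : ∀ n : ℕ, 0 < n → ∀ s, h2 ℏ k (-n) * Θ s - Θ s * h2 ℏ k (-n)
    = (qpow ℏ (v * n) * (qnum ℏ (w * n) / n)) • zmul (-n) Θ s

/-- The contour integral `∮ dw/(2π√-1) [F(z), X(w)]_ξ`, i.e. the coefficient of `w⁻¹`, of the
graded bracket `[F, X]_ξ = F X - (-1)^{[F][X]} ξ X F`; `p` and `p'` are the parities of `F`, `X`. -/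
def contourBracket (p p' : ℕ) (ξ : ℂ) (F X : Series) : Series := fun s =>
  F s * X (-1) - ((-1 : ℂ) ^ (p * p') * ξ) • (X (-1) * F s)

/-- The parities of the basis vectors `v₁, v₂, v₃, v₄` (indexed from `0`), which are also the
parities of the corresponding components. -/
def parity : Fin 4 → ℕ := ![0, 1, 1, 0]

/-- Recursion for `Φ₃, Φ₂, Φ₁`; component `Φ_r` is `Φ (r - 1)`, and `ρ`, `ρ'` are the square
roots of `[α]_q`, `[α+1]_q`. -/
def PhiRecursion (ℏ α ρ ρ' : ℂ) (Φ : Fin 4 → Series) : Prop :=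
  Φ 2 = (-ρ'⁻¹) • contourBracket (parity 3) 1 (qpow ℏ (-α - 1)) (Φ 3) (Xm2 ℏ α) ∧
  Φ 1 = contourBracket (parity 2) 0 (qpow ℏ 1) (Φ 2) (Xm1 ℏ α) ∧
  Φ 0 = (-ρ⁻¹) • contourBracket (parity 1) 1 (qpow ℏ (-α)) (Φ 1) (Xm2 ℏ α)

/-- Recursion for `Φ*₂, Φ*₃, Φ*₄`. -/
def PhiStarRecursion (ℏ α ρ ρ' : ℂ) (Φ : Fin 4 → Series) : Prop :=
  Φ 1 = (qpow ℏ (-α) / ρ) • contourBracket (parity 0) 1 (qpow ℏ α) (Φ 0) (Xm2 ℏ α) ∧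
  Φ 2 = (-qpow ℏ (-1)) • contourBracket (parity 1) 0 (qpow ℏ 1) (Φ 1) (Xm1 ℏ α) ∧
  Φ 3 = (-(qpow ℏ (-α - 1) / ρ')) •
    contourBracket (parity 2) 1 (qpow ℏ (α + 1)) (Φ 2) (Xm2 ℏ α)

/-- Recursion for `Ψ₂, Ψ₃, Ψ₄`. -/
def PsiRecursion (ℏ α ρ ρ' : ℂ) (Ψ : Fin 4 → Series) : Prop :=
  Ψ 1 = ρ⁻¹ • contourBracket (parity 0) 1 (qpow ℏ α) (Ψ 0) (Xp2 ℏ α) ∧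
  Ψ 2 = contourBracket (parity 1) 0 (qpow ℏ 1) (Ψ 1) (Xp1 ℏ α) ∧
  Ψ 3 = ρ'⁻¹ • contourBracket (parity 2) 1 (qpow ℏ (α + 1)) (Ψ 2) (Xp2 ℏ α)

/-- Recursion for `Ψ*₃, Ψ*₂, Ψ*₁`. -/
def PsiStarRecursion (ℏ α ρ ρ' : ℂ) (Ψ : Fin 4 → Series) : Prop :=
  Ψ 2 = (-(qpow ℏ (α + 1) / ρ')) •
    contourBracket (parity 3) 1 (qpow ℏ (-α - 1)) (Ψ 3) (Xp2 ℏ α) ∧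
  Ψ 1 = (-qpow ℏ 1) • contourBracket (parity 2) 0 (qpow ℏ 1) (Ψ 2) (Xp1 ℏ α) ∧
  Ψ 0 = (qpow ℏ α / ρ) • contourBracket (parity 1) 1 (qpow ℏ (-α)) (Ψ 1) (Xp2 ℏ α)

end QVertex

end

/-! All operators involved are built from normal-ordered exponentials, so every exchange relation
comes down to a contraction. The product `:e^E(z)::e^F(w):` is the normal-ordered product times
exp(∑ pₙ (w/z)ⁿ) and a zero-mode factor, where pₙ (`pairing`) is the commutator of the n-th
annihilation part of E with the n-th creation part of F. Two cases occur. If pₙ vanishes in both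
orders and the zero modes match, the exponentials commute (`normalExp_comm`). If pₙ = -λⁿ/n, the
contraction is 1 - λw/z, the zero modes supply a factor z, and the opposite order gives w - λ⁻¹z. As
z - λw = -λ(w - λ⁻¹z), the two orders agree as formal series up to a constant
(`normalExp_exchange`). The contraction is a polynomial in w/z, so no delta function appears.

On coefficients this rests on the equation tZ' = tT'Z, whose solution is determined by its constant
term. It gives exp(T) M(0) = M(t) exp(T) whenever tM' = [tT', M] (`expSeries_mul_C`), which moves
annihilation exponentials past creation operators. Energy bounds keep all sums finite.

The four elementary operators contain a¹, a² only through D_m = a¹_m + [2m]/[m] a²_m, which commutes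
with a¹ and has commutator -[m][(k+1)m]/m with a² (`Shape`). The raising currents contain no
a-oscillators, so φ₄ and φ*₁ commute with them. Without their sign factor, ψ₁ and ψ*₄ commute with
X^{-,1} and anticommute with X^{-,2}; the sign operator commutes with the first current and
anticommutes with the second, which turns both relations into commutation. The Cartan relations use
the same pairing against single oscillators, and the recursions for the other components are
triangular. -/

noncomputable section

namespace QVertex

/-! ### Exponentials of power series over a noncommutative algebra -/

section Euler

variable {A : Type*} [Ring A]

/-- The Euler operator `t d/dt` on power series. -/
def euler (f : PowerSeries A) : PowerSeries A := PowerSeries.mk fun n => n • PowerSeries.coeff n f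

@[simp]
theorem coeff_euler (f : PowerSeries A) (n : ℕ) :
    PowerSeries.coeff n (euler f) = n • PowerSeries.coeff n f := by
  simp [euler]

theorem euler_mul (f g : PowerSeries A) : euler (f * g) = euler f * g + f * euler g := by
  ext n
  simp only [coeff_euler, PowerSeries.coeff_mul, map_add, Finset.smul_sum, ← Finset.sum_add_distrib]
  refine Finset.sum_congr rfl fun x hx => ?_
  rw [← Finset.HasAntidiagonal.mem_antidiagonal.1 hx, smul_mul_assoc, mul_smul_comm, add_smul]

theorem euler_sub (f g : PowerSeries A) : euler (f - g) = euler f - euler g := by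
  ext n
  simp [smul_sub]

theorem euler_C (a : A) : euler (PowerSeries.C a) = 0 := by
  ext n
  rcases n with _ | n <;> simp [PowerSeries.coeff_C]

/-- Without commutativity of `A`, the power rule needs `f` to commute with its own derivative. -/
theorem euler_pow_succ {f : PowerSeries A} (h : Commute f (euler f)) (j : ℕ) :
    euler (f ^ (j + 1)) = (j + 1) • (euler f * f ^ j) := by
  induction j with
  | zero => simp
  | succ j ih =>
    rw [pow_succ, euler_mul, ih, smul_mul_assoc, mul_assoc, ← pow_succ, (h.pow_left (j + 1)).eq,
      add_smul (j + 1) 1, one_smul, add_comm]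

/-- Solutions of the linear equation `t Z' = τ Z` with `τ` and `Z` without constant term vanish. -/
theorem eq_zero_of_euler_eq [Algebra ℂ A] {τ Z : PowerSeries A}
    (hτ : PowerSeries.coeff 0 τ = 0) (h : euler Z = τ * Z) (h0 : PowerSeries.coeff 0 Z = 0) :
    Z = 0 := by
  ext n
  induction n using Nat.strong_induction_on with
  | _ n ih =>
    rcases Nat.eq_zero_or_pos n with rfl | hn
    · simpa using h0
    · have h1 : n • PowerSeries.coeff n Z = 0 := by
        rw [← coeff_euler, h, PowerSeries.coeff_mul]
        refine Finset.sum_eq_zero fun x hx => ?_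
        have hx' := Finset.HasAntidiagonal.mem_antidiagonal.1 hx
        -- `τ` has no constant term, so only coefficients of `Z` of degree below `n` enter;
        -- characteristic zero then removes the factor `n`.
        rcases Nat.eq_zero_or_pos x.1 with hx1 | hx1
        · simp [hx1, hτ]
        · rw [ih x.2 (by omega)]; simp
      have h2 : (n : ℂ) • PowerSeries.coeff n Z = 0 := by rw [Nat.cast_smul_eq_nsmul, h1]
      simpa [hn.ne'] using h2

end Euler

section Exponential

variable {A : Type*} [Ring A]

/-- The power series `∑_{n ≥ 1} T n t^n`. -/
def genSeries (T : ℕ+ → A) : PowerSeries A :=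
  PowerSeries.mk fun n => if h : 0 < n then T ⟨n, h⟩ else 0

@[simp]
theorem coeff_genSeries_coe (T : ℕ+ → A) (n : ℕ+) :
    PowerSeries.coeff (n : ℕ) (genSeries T) = T n := by
  rw [genSeries, PowerSeries.coeff_mk, dif_pos n.pos]
  rfl

@[simp]
theorem coeff_genSeries_zero (T : ℕ+ → A) : PowerSeries.coeff 0 (genSeries T) = 0 := by
  simp [genSeries]

theorem eq_zero_or_exists_pnat (n : ℕ) : n = 0 ∨ ∃ m : ℕ+, n = m := by
  rcases Nat.eq_zero_or_pos n with h | h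
  · exact Or.inl h
  · exact Or.inr ⟨⟨n, h⟩, rfl⟩

/-- A series without constant term has a `j`-th power starting in degree `j`; hence the truncated
sum in `expCoeff` is the full exponential. -/
theorem coeff_genSeries_pow {T : ℕ+ → A} (j n : ℕ) (h : n < j) :
    PowerSeries.coeff n (genSeries T ^ j) = 0 := by
  induction j generalizing n with
  | zero => omega
  | succ j ih =>
    rw [pow_succ, PowerSeries.coeff_mul]
    refine Finset.sum_eq_zero fun x hx => ?_
    have hx' := Finset.HasAntidiagonal.mem_antidiagonal.1 hx
    rcases Nat.eq_zero_or_pos x.2 with hx2 | hx2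
    · simp [hx2, genSeries]
    · rw [ih x.1 (by omega), zero_mul]

theorem genSeries_commute_euler {T : ℕ+ → A} (hT : ∀ m n, Commute (T m) (T n)) :
    Commute (genSeries T) (euler (genSeries T)) := by
  ext n
  rw [PowerSeries.coeff_mul, PowerSeries.coeff_mul, ← Finset.Nat.sum_antidiagonal_swap]
  refine Finset.sum_congr rfl fun x _ => ?_
  simp only [coeff_euler, genSeries, PowerSeries.coeff_mk, Prod.fst_swap, Prod.snd_swap]
  split_ifs
  · rw [mul_smul_comm, smul_mul_assoc]
    exact congrArg _ (hT _ _).eq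
  all_goals simp

variable [Algebra ℂ A]

/-- The exponential of `genSeries T`. -/
def expSeries (T : ℕ+ → A) : PowerSeries A := PowerSeries.mk (expCoeff T)

/-- The cutoff can be raised freely, so that coefficients of different degrees are summed over a
common range. -/
theorem expCoeff_eq_sum {T : ℕ+ → A} {N K : ℕ} (h : N < K) :
    expCoeff T N = ∑ j ∈ Finset.range K, ((j ! : ℂ)⁻¹) • PowerSeries.coeff N (genSeries T ^ j) := by
  unfold expCoeff
  refine Finset.sum_subset (fun j => by simp only [Finset.mem_range]; omega) fun j _ hj => ?_
  have := coeff_genSeries_pow (T := T) j N (by simpa using hj)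
  rw [genSeries] at this
  rw [this, smul_zero]

@[simp]
theorem expCoeff_zero (T : ℕ+ → A) : expCoeff T 0 = 1 := by
  simp [expCoeff]

/-- The differential equation that characterizes exp(T). Commutativity of the `T n` lets the
derivative of each power be gathered on the left. -/
theorem euler_expSeries {T : ℕ+ → A} (hT : ∀ m n, Commute (T m) (T n)) :
    euler (expSeries T) = euler (genSeries T) * expSeries T := by
  have hc := genSeries_commute_euler hT
  ext N
  have hr : ∀ x ∈ Finset.HasAntidiagonal.antidiagonal N,
      PowerSeries.coeff x.1 (euler (genSeries T)) * PowerSeries.coeff x.2 (expSeries T)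
        = ∑ j ∈ Finset.range (N + 1), ((j ! : ℂ)⁻¹) •
          (PowerSeries.coeff x.1 (euler (genSeries T)) *
            PowerSeries.coeff x.2 (genSeries T ^ j)) := by
    intro x hx
    have hx' := Finset.HasAntidiagonal.mem_antidiagonal.1 hx
    rw [expSeries, PowerSeries.coeff_mk, expCoeff_eq_sum (show x.2 < N + 1 by omega),
      Finset.mul_sum]
    simp only [mul_smul_comm]
  -- The left side keeps one more power than the right: once the zeroth power is dropped, the shift
  -- `j ↦ j + 1` matches the sums, since (j+1)/(j+1)! = 1/j!.
  rw [coeff_euler, PowerSeries.coeff_mul, Finset.sum_congr rfl hr, Finset.sum_comm, expSeries,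
    PowerSeries.coeff_mk, expCoeff_eq_sum (show N < N + 1 + 1 by omega), Finset.sum_range_succ',
    smul_add, Finset.smul_sum]
  have h0 : N • ((0 ! : ℂ)⁻¹ • PowerSeries.coeff N (genSeries T ^ 0)) = 0 := by
    rcases N with _ | N <;> simp [PowerSeries.coeff_one]
  rw [h0, add_zero]
  refine Finset.sum_congr rfl fun j _ => ?_
  rw [← Finset.smul_sum, ← PowerSeries.coeff_mul, smul_comm, ← coeff_euler, euler_pow_succ hc,
    map_nsmul, ← Nat.cast_smul_eq_nsmul ℂ, smul_smul, Nat.factorial_succ]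
  congr 1
  have : (j ! : ℂ) ≠ 0 := by exact_mod_cast j.factorial_ne_zero
  have : ((j + 1 : ℕ) : ℂ) ≠ 0 := by exact_mod_cast j.succ_ne_zero
  push_cast at *
  field_simp

/-- If `M(t)` solves `t M' = [t T', M]`, then `exp(T) M(0) = M(t) exp(T)`. -/
theorem expSeries_mul_C {T : ℕ+ → A} (hT : ∀ m n, Commute (T m) (T n)) (M : PowerSeries A)
    (hM : euler M = euler (genSeries T) * M - M * euler (genSeries T)) :
    expSeries T * PowerSeries.C (PowerSeries.coeff 0 M) = M * expSeries T := by
  -- Both sides solve `euler Z = euler (genSeries T) * Z` with the same constant term.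
  rw [← sub_eq_zero]
  refine eq_zero_of_euler_eq (τ := euler (genSeries T)) (by simp) ?_ ?_
  · rw [euler_sub, euler_mul, euler_mul, euler_C, hM, euler_expSeries hT]
    noncomm_ring
  · simp [expSeries]

theorem commute_expCoeff {T : ℕ+ → A} {M : A} (hT : ∀ n, Commute (T n) M) (N : ℕ) :
    Commute (expCoeff T N) M := by
  have h : ∀ j N, Commute (PowerSeries.coeff N (genSeries T ^ j)) M := by
    intro j
    induction j with
    | zero =>
      intro N
      rw [pow_zero, PowerSeries.coeff_one]
      split_ifs <;> simp
    | succ j ih =>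
      intro N
      rw [pow_succ, PowerSeries.coeff_mul]
      refine Commute.sum_left _ _ _ fun x _ => (ih x.1).mul_left ?_
      rw [genSeries, PowerSeries.coeff_mk]
      split_ifs
      · exact hT _
      · simp
  rw [expCoeff_eq_sum (Nat.lt_succ_self N)]
  exact Commute.sum_left _ _ _ fun j _ => (h j N).smul_left _

end Exponential

open Boson

/-! ### Creation and annihilation parts -/

/-- The annihilation operator `∑_i v i • i_n` as a derivation. -/
def annihDer (ℏ k : ℂ) (v : Boson → ℂ) (n : ℕ+) : Derivation ℂ Pol Pol :=
  ∑ i, v i • ∑ j, oscComm ℏ k i j n • MvPolynomial.pderiv (j, n)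

/-- The annihilation operator `∑_i v i • i_n`. -/
def annihOp (ℏ k : ℂ) (v : Boson → ℂ) (n : ℕ+) : Module.End ℂ Pol :=
  ∑ i, v i • annihPol ℏ k i n

/-- The creation operator `∑_j w j • j_{-n}`. -/
def createVec (w : Boson → ℂ) (n : ℕ+) : Pol := ∑ j, w j • MvPolynomial.X (j, n)

/-- The commutator of `∑_i v i • i_n` and `∑_j w j • j_{-n}`. -/
def pairing (ℏ k : ℂ) (v w : Boson → ℂ) (n : ℤ) : ℂ := ∑ i, ∑ j, v i * w j * oscComm ℏ k i j n

theorem derivation_sum_apply {ι : Type*} (s : Finset ι) (D : ι → Derivation ℂ Pol Pol) (P : Pol) :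
    (∑ i ∈ s, D i) P = ∑ i ∈ s, D i P := by
  classical
  induction s using Finset.induction_on with
  | empty => simp
  | insert i s hi ih => simp [Finset.sum_insert hi, ih]

theorem annihOp_apply (ℏ k : ℂ) (v : Boson → ℂ) (n : ℕ+) (P : Pol) :
    annihOp ℏ k v n P = annihDer ℏ k v n P := by
  simp [annihOp, annihDer, annihPol, derivation_sum_apply]

theorem annihOp_mul (ℏ k : ℂ) (v : Boson → ℂ) (n : ℕ+) (P Q : Pol) :
    annihOp ℏ k v n (P * Q) = annihOp ℏ k v n P * Q + P * annihOp ℏ k v n Q := by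
  simp only [annihOp_apply, Derivation.leibniz, smul_eq_mul]
  ring

theorem annihOp_one (ℏ k : ℂ) (v : Boson → ℂ) (n : ℕ+) : annihOp ℏ k v n 1 = 0 := by
  simp [annihOp_apply]

theorem annihOp_C (ℏ k : ℂ) (v : Boson → ℂ) (n : ℕ+) (a : ℂ) :
    annihOp ℏ k v n (MvPolynomial.C a) = 0 := by
  rw [annihOp_apply, ← MvPolynomial.algebraMap_eq, Derivation.map_algebraMap]

theorem annihOp_X (ℏ k : ℂ) (v : Boson → ℂ) (n m : ℕ+) (j : Boson) :
    annihOp ℏ k v n (MvPolynomial.X (j, m))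
      = MvPolynomial.C (if n = m then ∑ i, v i * oscComm ℏ k i j n else 0) := by
  classical
  simp only [annihOp_apply, annihDer, derivation_sum_apply, Derivation.smul_apply,
    MvPolynomial.pderiv_X, Pi.single_apply, Prod.mk.injEq]
  split_ifs with h
  · subst h
    simp [Finset.sum_ite_eq, MvPolynomial.smul_eq_C_mul]
  · simp [Ne.symm h]

theorem annihOp_createVec (ℏ k : ℂ) (v w : Boson → ℂ) (n m : ℕ+) :
    annihOp ℏ k v n (createVec w m)
      = MvPolynomial.C (if n = m then pairing ℏ k v w n else 0) := by
  simp only [createVec, map_sum, map_smul, annihOp_X]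
  simp only [MvPolynomial.smul_eq_C_mul, ← map_mul]
  split_ifs
  · rw [← map_sum, pairing, Finset.sum_comm]
    simp only [Finset.mul_sum]
    congr 1
    exact Finset.sum_congr rfl fun _ _ => Finset.sum_congr rfl fun _ _ => by ring
  · simp

/-- A commutator of derivations is a derivation, so it suffices to check variables; each operator
sends a variable to a constant, which the other kills. -/
theorem annihOp_commute (ℏ k : ℂ) (v w : Boson → ℂ) (n m : ℕ+) :
    Commute (annihOp ℏ k v n) (annihOp ℏ k w m) := by
  have h : ⁅annihDer ℏ k v n, annihDer ℏ k w m⁆ = 0 := by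
    refine MvPolynomial.derivation_ext fun i => ?_
    rw [Derivation.commutator_apply, ← annihOp_apply, ← annihOp_apply, ← annihOp_apply,
      ← annihOp_apply]
    obtain ⟨i, l⟩ := i
    simp only [annihOp_X, annihOp_C, sub_zero, Derivation.coe_zero, Pi.zero_apply]
  refine LinearMap.ext fun P => ?_
  have h2 := congrArg (fun D : Derivation ℂ Pol Pol => D P) h
  simp only [Derivation.commutator_apply, ← annihOp_apply, Derivation.coe_zero, Pi.zero_apply,
    sub_eq_zero] at h2
  simpa using h2

/-- `createCoeff`, extended by zero to negative degrees. -/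
def createZ (E : Exponent) (n : ℤ) : Pol := if 0 ≤ n then createCoeff E n.toNat else 0

@[simp]
theorem createZ_natCast (E : Exponent) (n : ℕ) : createZ E n = createCoeff E n := by
  simp [createZ]

theorem createZ_of_neg (E : Exponent) {n : ℤ} (h : n < 0) : createZ E n = 0 := by
  simp [createZ, h.not_ge]

theorem createCoeff_eq (E : Exponent) :
    createCoeff E = expCoeff fun n : ℕ+ => createVec (fun i => E.coef i (-n)) n := rfl

theorem annihCoeff_eq (ℏ k : ℂ) (E : Exponent) :
    annihCoeff ℏ k E = expCoeff fun n : ℕ+ => annihOp ℏ k (fun i => E.coef i n) n := rfl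

/-- The derivation `D` sends the exponent of the creation part to the scalar term p tⁿ, so it
multiplies the exponential by p tⁿ. This is derived from uniqueness for the Euler equation, with `D`
applied coefficientwise. -/
theorem annihOp_createCoeff (ℏ k : ℂ) (v : Boson → ℂ) (F : Exponent) (n : ℕ+) (N : ℕ) :
    annihOp ℏ k v n (createCoeff F N)
      = MvPolynomial.C (pairing ℏ k v (fun i => F.coef i (-n)) n) * createZ F (N - n) := by
  set D := annihOp ℏ k v n with hD
  set p := pairing ℏ k v (fun i => F.coef i (-n)) n with hp
  set T : ℕ+ → Pol := fun n => createVec (fun i => F.coef i (-n)) n with hT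
  let map (f : PowerSeries Pol) : PowerSeries Pol :=
    PowerSeries.mk fun n => D (PowerSeries.coeff n f)
  have hmul : ∀ f g, map (f * g) = map f * g + f * map g := by
    intro f g
    ext1 N
    simp only [map, PowerSeries.coeff_mk, PowerSeries.coeff_mul, map_sum, map_add, hD, annihOp_mul,
      Finset.sum_add_distrib]
  have heul : ∀ f, map (euler f) = euler (map f) := by
    intro f
    ext1 N
    simp only [map, PowerSeries.coeff_mk, coeff_euler, map_nsmul]
  have hgen : map (genSeries T) = PowerSeries.monomial (n : ℕ) (MvPolynomial.C p) := by
    ext1 N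
    rw [PowerSeries.coeff_monomial]
    simp only [map, PowerSeries.coeff_mk]
    obtain rfl | ⟨N, rfl⟩ := eq_zero_or_exists_pnat N
    · rw [if_neg n.ne_zero.symm, coeff_genSeries_zero, map_zero]
    · rw [coeff_genSeries_coe, hD, hT, annihOp_createVec]
      rcases eq_or_ne n N with rfl | h
      · simp [hp]
      · rw [if_neg h, if_neg (fun h' => h (PNat.eq h'.symm)), map_zero]
  have hexp := euler_expSeries (T := T) fun _ _ => mul_comm _ _
  have key :
      map (expSeries T) - PowerSeries.monomial (n : ℕ) (MvPolynomial.C p) * expSeries T = 0 := by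
    refine eq_zero_of_euler_eq (τ := euler (genSeries T)) (by simp) ?_ ?_
    · have hmon : euler (PowerSeries.monomial (n : ℕ) (MvPolynomial.C p : Pol))
          = map (euler (genSeries T)) := by rw [heul, hgen]
      rw [euler_sub, euler_mul, ← heul, hexp, hmul, hmon]
      ring
    · rw [map_sub, PowerSeries.monomial_eq_C_mul_X_pow, mul_assoc, PowerSeries.coeff_C_mul,
        PowerSeries.coeff_X_pow_mul', if_neg (by have := n.pos; omega)]
      simp [map, expSeries, hD, annihOp_one]
  have h := congrArg (PowerSeries.coeff N) (sub_eq_zero.1 key)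
  rw [PowerSeries.monomial_eq_C_mul_X_pow, mul_assoc, PowerSeries.coeff_C_mul,
    PowerSeries.coeff_X_pow_mul'] at h
  simp only [map, PowerSeries.coeff_mk, expSeries] at h
  rw [createCoeff_eq, ← hT, h]
  congr 1
  unfold createZ
  split_ifs with h1 h2 h2
  · rw [createCoeff_eq, show ((N : ℤ) - (n : ℕ)).toNat = N - n by omega]
  · omega
  · omega
  · rfl

theorem annihOp_createZ (ℏ k : ℂ) (v : Boson → ℂ) (F : Exponent) (n : ℕ+) (N : ℤ) :
    annihOp ℏ k v n (createZ F N)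
      = MvPolynomial.C (pairing ℏ k v (fun i => F.coef i (-n)) n) * createZ F (N - n) := by
  rcases lt_or_ge N 0 with h | h
  · have := n.pos
    rw [createZ_of_neg F h, createZ_of_neg F (by omega)]
    simp
  · lift N to ℕ using h
    rw [createZ_natCast, annihOp_createCoeff]

/-- Moving `exp(T)` past the multiplication by `f` if `f + g t^m` is its conjugate. -/
theorem annihCoeff_mul (ℏ k : ℂ) (E : Exponent) (f g : Pol) (m : ℕ+)
    (h1 : ∀ a < m, annihOp ℏ k (fun i => E.coef i a) a f = 0)
    (h2 : annihOp ℏ k (fun i => E.coef i m) m f = g)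
    (h3 : ∀ a : ℕ+, ((m + a : ℕ+) : ℕ) • annihOp ℏ k (fun i => E.coef i (m + a : ℕ+)) (m + a) f
      + (a : ℕ) • annihOp ℏ k (fun i => E.coef i a) a g = 0) (r : ℕ) (P : Pol) :
    annihCoeff ℏ k E r (f * P) = f * annihCoeff ℏ k E r P
      + if (m : ℕ) ≤ r then g * annihCoeff ℏ k E (r - m) P else 0 := by
  set T : ℕ+ → Module.End ℂ Pol := fun n => annihOp ℏ k (fun i => E.coef i n) n with hT
  have hTc : ∀ m n, Commute (T m) (T n) := fun m n => annihOp_commute _ _ _ _ _ _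
  -- `T n` is a derivation, so its commutator with multiplication by `F` is multiplication by `T n
  -- F`.
  have hbr : ∀ n F, T n * LinearMap.mulLeft ℂ F - LinearMap.mulLeft ℂ F * T n
      = LinearMap.mulLeft ℂ (T n F) := by
    intro n F
    refine LinearMap.ext fun P => ?_
    simp [hT, annihOp_mul]
  have hgen : ∀ n F, PowerSeries.coeff n (euler (genSeries T)) * LinearMap.mulLeft ℂ F
      - LinearMap.mulLeft ℂ F * PowerSeries.coeff n (euler (genSeries T))
      = LinearMap.mulLeft ℂ (PowerSeries.coeff n (euler (genSeries T)) F) := by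
    intro n F
    rw [coeff_euler]
    obtain rfl | ⟨n, rfl⟩ := eq_zero_or_exists_pnat n
    · simp
    · rw [coeff_genSeries_coe, smul_mul_assoc, mul_smul_comm, ← nsmul_sub, hbr]
      refine LinearMap.ext fun P => ?_
      simp
  -- `M = f + g t^m` is the proposed conjugate of multiplication by `f`; `h1`, `h2`, `h3` are its
  -- differential equation in degrees below, at and above `m`.
  set M : PowerSeries (Module.End ℂ Pol) := PowerSeries.C (LinearMap.mulLeft ℂ f)
    + PowerSeries.C (LinearMap.mulLeft ℂ g) * PowerSeries.X ^ (m : ℕ) with hM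
  have hM0 : PowerSeries.coeff 0 M = LinearMap.mulLeft ℂ f := by
    simp [hM]
  have hMe : euler M = euler (genSeries T) * M - M * euler (genSeries T) := by
    ext1 a
    have e1 : euler (genSeries T) * M - M * euler (genSeries T)
        = (euler (genSeries T) * PowerSeries.C (LinearMap.mulLeft ℂ f)
          - PowerSeries.C (LinearMap.mulLeft ℂ f) * euler (genSeries T))
        + (euler (genSeries T) * PowerSeries.C (LinearMap.mulLeft ℂ g)
          - PowerSeries.C (LinearMap.mulLeft ℂ g) * euler (genSeries T)) *
            PowerSeries.X ^ (m : ℕ) := by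
      have := (PowerSeries.commute_X_pow (euler (genSeries T)) (m : ℕ)).eq
      rw [hM, sub_mul, add_mul, mul_add, mul_assoc _ (PowerSeries.X ^ (m : ℕ)), ← this]
      noncomm_ring
    rw [e1, map_add, map_sub, PowerSeries.coeff_mul_C, PowerSeries.coeff_C_mul, hgen,
      PowerSeries.coeff_mul_X_pow', map_sub, PowerSeries.coeff_mul_C, PowerSeries.coeff_C_mul, hgen]
    have hM' : PowerSeries.coeff a (euler M) = if a = m then a • LinearMap.mulLeft ℂ g else 0 := by
      rw [hM, coeff_euler, map_add, PowerSeries.coeff_C, PowerSeries.coeff_C_mul,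
        PowerSeries.coeff_X_pow]
      obtain rfl | ⟨a, rfl⟩ := eq_zero_or_exists_pnat a
      · simp [m.ne_zero.symm]
      · simp
    rw [hM']
    refine LinearMap.ext fun P => ?_
    rcases lt_trichotomy a m with ha | rfl | ha
    · rw [if_neg ha.ne, if_neg ha.not_ge, coeff_euler]
      obtain rfl | ⟨a, rfl⟩ := eq_zero_or_exists_pnat a
      · simp
      · simp [hT, h1 a (by exact_mod_cast ha)]
    · simp [hT, h2]
    · obtain ⟨b, rfl⟩ : ∃ b : ℕ+, a = (m + b : ℕ+) :=
        ⟨⟨a - m, by omega⟩, by change a = m + (a - m); omega⟩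
      have e : ((m + b : ℕ+) : ℕ) - m = b := by rw [PNat.add_coe]; omega
      rw [if_neg ha.ne', if_pos ha.le, coeff_euler, coeff_euler, e, coeff_genSeries_coe,
        coeff_genSeries_coe]
      simp only [LinearMap.add_apply, LinearMap.mulLeft_apply, LinearMap.zero_apply, ← add_mul,
        LinearMap.smul_apply, hT, h3 b, zero_mul]
  have h4 := expSeries_mul_C hTc M hMe
  rw [hM0, hM, add_mul, mul_assoc] at h4
  replace h4 := congrArg (fun f => (PowerSeries.coeff r f : Module.End ℂ Pol) P) h4
  simp only [PowerSeries.coeff_mul_C, PowerSeries.coeff_C_mul,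
    map_add, PowerSeries.coeff_X_pow_mul', LinearMap.add_apply, expSeries, PowerSeries.coeff_mk,
    Module.End.mul_apply, LinearMap.mulLeft_apply] at h4
  rw [annihCoeff_eq, ← hT, h4]
  split_ifs <;> simp

/-! ### The oscillator part of a normal-ordered exponential -/

theorem below_mono {v w : ℕ} (h : v ≤ w) : below v ≤ below w :=
  MvPolynomial.restrictSupport_mono ℂ fun _ hm => lt_of_lt_of_le hm h

theorem annihCoeff_of_le {ℏ k : ℂ} (E : Exponent) {P : Pol} {w r : ℕ} (hP : P ∈ below w)
    (h : w ≤ r) : annihCoeff ℏ k E r P = 0 := by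
  have h := annihCoeff_mem ℏ k E r r P (below_mono h hP)
  rw [Nat.sub_self] at h
  unfold below at h
  rw [MvPolynomial.mem_restrictSupport_iff] at h
  rw [← MvPolynomial.support_eq_empty, Finset.eq_empty_iff_forall_notMem]
  intro m hm
  exact absurd (h hm) (by simp)

/-- Annihilation coefficients of degree at least `w` kill vectors of energy below `w`. Any larger
bound also works, which gives several vectors a common range. -/
theorem oscCoeff_eq_sum {ℏ k : ℂ} (E : Exponent) (d : ℤ) {P : Pol} {w : ℕ} (hP : P ∈ below w) :
    oscCoeff ℏ k E d P
      = ∑ r ∈ Finset.range w, createZ E (d + r) * annihCoeff ℏ k E r P := by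
  change (∑ᶠ r : ℕ, if 0 ≤ d + r then createCoeff E (d + r).toNat * annihCoeff ℏ k E r P else 0) = _
  rw [finsum_eq_sum_of_support_subset (s := Finset.range w)]
  · refine Finset.sum_congr rfl fun r _ => ?_
    unfold createZ
    split_ifs <;> simp
  · intro r hr
    by_contra h
    have h' : w ≤ r := by simpa using h
    exact hr (by simp [annihCoeff_of_le E hP h'])

/-- Moving a normal-ordered exponential past a multiplication operator. -/
theorem oscCoeff_mul {ℏ k : ℂ} (E : Exponent) {f g : Pol} {m : ℕ}
    (h : ∀ r P, annihCoeff ℏ k E r (f * P) = f * annihCoeff ℏ k E r P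
      + if m ≤ r then g * annihCoeff ℏ k E (r - m) P else 0) (d : ℤ) (P : Pol) :
    oscCoeff ℏ k E d (f * P) = f * oscCoeff ℏ k E d P + g * oscCoeff ℏ k E (d + m) P := by
  obtain ⟨w₁, h₁⟩ := exists_mem_below P
  obtain ⟨w₂, h₂⟩ := exists_mem_below (f * P)
  have hP := below_mono (le_max_left w₁ w₂) h₁
  -- The bound is enlarged by `m`: terms with `r < m` have no `g` part, and shifting `r` by `m`
  -- brings the rest back to the range used for `P`.
  have hfP := below_mono ((le_max_right w₁ w₂).trans (Nat.le_add_left _ m)) h₂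
  rw [oscCoeff_eq_sum E d hfP, oscCoeff_eq_sum E d (below_mono (Nat.le_add_left _ m) hP),
    oscCoeff_eq_sum E (d + m) hP]
  simp only [h, mul_add, Finset.sum_add_distrib, Finset.mul_sum]
  congr 1
  · exact Finset.sum_congr rfl fun _ _ => by ring
  · rw [Finset.sum_range_add, Finset.sum_eq_zero, zero_add]
    · refine Finset.sum_congr rfl fun r _ => ?_
      rw [if_pos (Nat.le_add_right _ _), Nat.add_sub_cancel_left]
      push_cast
      rw [add_assoc]
      ring
    · intro r hr
      rw [if_neg (by simpa using hr), mul_zero]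

/-- A creation operator has scalar commutators with annihilation operators, so its conjugate has a
single extra term, in degree `m`. -/
theorem oscCoeff_mul_X (ℏ k : ℂ) (E : Exponent) (i : Boson) (m : ℕ+) (d : ℤ) (P : Pol) :
    oscCoeff ℏ k E d (MvPolynomial.X (i, m) * P) = MvPolynomial.X (i, m) * oscCoeff ℏ k E d P
      + (∑ j, E.coef j m * oscComm ℏ k j i m) • oscCoeff ℏ k E (d + m) P := by
  rw [MvPolynomial.smul_eq_C_mul]
  refine oscCoeff_mul E (fun r P => annihCoeff_mul ℏ k E _ _ m ?_ ?_ ?_ r P) d P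
  · intro a ha
    rw [annihOp_X, if_neg ha.ne, map_zero]
  · rw [annihOp_X, if_pos rfl]
  · intro a
    have : m + a ≠ m := by
      intro h
      have := congrArg PNat.val h
      have := a.pos
      simp at *
    rw [annihOp_X, if_neg this, annihOp_C]
    simp

/-- The scalar exp(-∑ λⁿtⁿ/n) = 1 - λt has two terms, so the conjugation stops after degree one. -/
theorem oscCoeff_mul_createZ {ℏ k : ℂ} {E F : Exponent} {lam : ℂ}
    (h : ∀ n : ℕ+,
      pairing ℏ k (fun i => E.coef i n) (fun i => F.coef i (-n)) n = -(lam ^ (n : ℕ) / n))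
    (N d : ℤ) (P : Pol) :
    oscCoeff ℏ k E d (createZ F N * P) = createZ F N * oscCoeff ℏ k E d P
      - lam • (createZ F (N - 1) * oscCoeff ℏ k E (d + 1) P) := by
  have key : ∀ (n : ℕ+) N, annihOp ℏ k (fun i => E.coef i n) n (createZ F N)
      = MvPolynomial.C (-(lam ^ (n : ℕ) / n)) * createZ F (N - n) := by
    intro n N
    rw [annihOp_createZ, h]
  have := oscCoeff_mul (m := 1) E (fun r P => annihCoeff_mul ℏ k E (createZ F N)
    (MvPolynomial.C (-lam) * createZ F (N - 1)) 1 ?_ ?_ ?_ r P) d P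
  · rw [this, MvPolynomial.smul_eq_C_mul, map_neg]
    push_cast
    ring
  · intro a ha
    exact absurd ha not_lt_one
  · rw [key]
    simp
  · intro a
    rw [annihOp_mul, annihOp_C, key, key, ← Nat.cast_smul_eq_nsmul ℂ, ← Nat.cast_smul_eq_nsmul ℂ,
      MvPolynomial.smul_eq_C_mul, MvPolynomial.smul_eq_C_mul]
    have e : N - 1 - (a : ℕ) = N - ((1 + a : ℕ+) : ℕ) := by
      push_cast; ring
    have ha : ((a : ℕ) : ℂ) ≠ 0 := by exact_mod_cast a.ne_zero
    have ha' : (((1 + a : ℕ+) : ℕ) : ℂ) ≠ 0 := by exact_mod_cast (1 + a).ne_zero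
    -- The cancellation in degree `1 + a`: the term from `f` gives -λ·λᵃ, the one from `g` gives
    -- λ·λᵃ.
    have e1 : (((1 + a : ℕ+) : ℕ) : ℂ) * (-(lam ^ ((1 + a : ℕ+) : ℕ) / ((1 + a : ℕ+) : ℕ)))
        = -(lam * lam ^ (a : ℕ)) := by
      rw [mul_neg, mul_div_cancel₀ _ ha', PNat.add_coe, PNat.one_coe, pow_add, pow_one]
    have e2 : ((a : ℕ) : ℂ) * (-lam * (-(lam ^ (a : ℕ) / (a : ℕ)))) = lam * lam ^ (a : ℕ) := by
      field_simp
    rw [e, zero_mul, zero_add, ← mul_assoc, ← map_mul, e1, ← mul_assoc, ← mul_assoc, ← map_mul,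
      ← map_mul, mul_assoc, e2, ← add_mul, ← map_add]
    simp

/-- `i_n` past the oscillator part. -/
theorem annihPol_eq (ℏ k : ℂ) (i : Boson) (n : ℕ+) :
    annihPol ℏ k i n = annihOp ℏ k (fun j => if j = i then 1 else 0) n := by
  simp [annihOp]

/-- `i_n` commutes with the annihilation part and acts as a derivation on the creation part, where
it produces a scalar and lowers the degree by `n`. -/
theorem annihPol_oscCoeff (ℏ k : ℂ) (E : Exponent) (i : Boson) (n : ℕ+) (d : ℤ) (P : Pol) :
    annihPol ℏ k i n (oscCoeff ℏ k E d P) = oscCoeff ℏ k E d (annihPol ℏ k i n P)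
      + (∑ j, oscComm ℏ k i j n * E.coef j (-n)) • oscCoeff ℏ k E (d - n) P := by
  obtain ⟨w, hP⟩ := exists_mem_below P
  have hD : annihPol ℏ k i n P ∈ below w :=
    below_mono (Nat.sub_le _ _) (annihPol_mem ℏ k i n w hP)
  have hc : ∀ r, Commute (annihCoeff ℏ k E r) (annihPol ℏ k i n) := fun r => by
    rw [annihPol_eq, annihCoeff_eq]
    exact commute_expCoeff (fun _ => annihOp_commute _ _ _ _ _ _) r
  have hp : pairing ℏ k (fun j => if j = i then 1 else 0) (fun j => E.coef j (-n)) n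
      = ∑ j, oscComm ℏ k i j n * E.coef j (-n) := by
    simp [pairing, mul_comm]
  rw [oscCoeff_eq_sum E d hP, oscCoeff_eq_sum E d hD, oscCoeff_eq_sum E (d - n) hP, map_sum,
    MvPolynomial.smul_eq_C_mul, Finset.mul_sum, ← Finset.sum_add_distrib]
  refine Finset.sum_congr rfl fun r _ => ?_
  have h1 := LinearMap.congr_fun (hc r).eq P
  simp only [Module.End.mul_apply] at h1
  rw [h1, annihPol_eq, annihOp_mul, annihOp_createZ, hp,
    show d + (r : ℤ) - (n : ℕ) = d - (n : ℕ) + r by ring]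
  ring

/-- The normal-ordered product of the oscillator parts of two exponentials. -/
def normalProd (ℏ k : ℂ) (E F : Exponent) (d e : ℤ) (w : ℕ) (P : Pol) : Pol :=
  ∑ s ∈ Finset.range w, createZ F (e + s) * oscCoeff ℏ k E d (annihCoeff ℏ k F s P)

/-- Creation parts commute as polynomials and annihilation parts as operators, so normal ordering
forgets the order of the factors. -/
theorem normalProd_comm (ℏ k : ℂ) (E F : Exponent) (d e : ℤ) {w : ℕ} {P : Pol}
    (hP : P ∈ below w) : normalProd ℏ k E F d e w P = normalProd ℏ k F E e d w P := by
  have hmem : ∀ (E : Exponent) (r : ℕ), annihCoeff ℏ k E r P ∈ below w := fun E r =>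
    below_mono (Nat.sub_le _ _) (annihCoeff_mem ℏ k E r w P hP)
  have hc : ∀ r s, annihCoeff ℏ k E r (annihCoeff ℏ k F s P)
      = annihCoeff ℏ k F s (annihCoeff ℏ k E r P) := fun r s => by
    have : Commute (annihCoeff ℏ k E r) (annihCoeff ℏ k F s) := by
      rw [annihCoeff_eq, annihCoeff_eq]
      exact commute_expCoeff
        (fun _ => (commute_expCoeff (fun _ => annihOp_commute _ _ _ _ _ _) s).symm) r
    simpa using LinearMap.congr_fun this.eq P
  unfold normalProd
  simp only [oscCoeff_eq_sum _ _ (hmem _ _), Finset.mul_sum]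
  rw [Finset.sum_comm]
  refine Finset.sum_congr rfl fun r _ => Finset.sum_congr rfl fun s _ => ?_
  rw [hc]
  ring

/-- The coefficient of z^d w^e in (1 - λw/z) times the normal-ordered product; λ = 0 is the case of
trivial contraction. -/
theorem oscCoeff_mul_oscCoeff {ℏ k : ℂ} {E F : Exponent} {lam : ℂ}
    (h : ∀ n : ℕ+,
      pairing ℏ k (fun i => E.coef i n) (fun i => F.coef i (-n)) n = -(lam ^ (n : ℕ) / n))
    (d e : ℤ) {w : ℕ} {P : Pol} (hP : P ∈ below w) :
    oscCoeff ℏ k E d (oscCoeff ℏ k F e P)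
      = normalProd ℏ k E F d e w P - lam • normalProd ℏ k E F (d + 1) (e - 1) w P := by
  rw [oscCoeff_eq_sum F e hP, map_sum, normalProd, normalProd, Finset.smul_sum,
    ← Finset.sum_sub_distrib]
  refine Finset.sum_congr rfl fun s _ => ?_
  rw [oscCoeff_mul_createZ h, show e + (s : ℤ) - 1 = e - 1 + s by ring]

open Classical in
/-- The coefficient of `z^x` in the oscillator part, extended by zero to all complex exponents. -/
def oscZ (ℏ k : ℂ) (E : Exponent) (x : ℂ) : Module.End ℂ Pol :=
  if x = (⌊x.re⌋ : ℂ) then oscCoeff ℏ k E ⌊x.re⌋ else 0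

@[simp]
theorem oscZ_intCast (ℏ k : ℂ) (E : Exponent) (n : ℤ) : oscZ ℏ k E n = oscCoeff ℏ k E n := by
  simp [oscZ]

theorem oscZ_of_forall_ne (ℏ k : ℂ) (E : Exponent) {x : ℂ} (h : ∀ n : ℤ, x ≠ n) :
    oscZ ℏ k E x = 0 := if_neg (h _)

/-- The contraction of the oscillator parts is trivial in both orders. -/
theorem oscZ_comm {ℏ k : ℂ} {E F : Exponent}
    (h : ∀ n : ℕ+, pairing ℏ k (fun i => E.coef i n) (fun i => F.coef i (-n)) n = 0)
    (h' : ∀ n : ℕ+, pairing ℏ k (fun i => F.coef i n) (fun i => E.coef i (-n)) n = 0)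
    (x y : ℂ) (P : Pol) :
    oscZ ℏ k E x (oscZ ℏ k F y P) = oscZ ℏ k F y (oscZ ℏ k E x P) := by
  by_cases hx : ∃ n : ℤ, x = n
  · by_cases hy : ∃ n : ℤ, y = n
    · obtain ⟨d, rfl⟩ := hx
      obtain ⟨e, rfl⟩ := hy
      obtain ⟨w, hP⟩ := exists_mem_below P
      rw [oscZ_intCast, oscZ_intCast,
        oscCoeff_mul_oscCoeff (lam := 0) (by simpa using h) d e hP,
        oscCoeff_mul_oscCoeff (lam := 0) (by simpa using h') e d hP, normalProd_comm ℏ k E F d e hP]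
      simp
    · rw [oscZ_of_forall_ne ℏ k F (by simpa using hy)]; simp
  · rw [oscZ_of_forall_ne ℏ k E (by simpa using hx)]; simp

theorem forall_sub_one_ne {x : ℂ} (h : ∀ n : ℤ, x ≠ n) (n : ℤ) : x - 1 ≠ n := fun h' =>
  h (n + 1) (by push_cast; linear_combination h')

/-- The contractions are `1 - λ w / z` and `1 - λ⁻¹ z / w`. -/
theorem oscZ_exchange {ℏ k : ℂ} {E F : Exponent} {lam lam' : ℂ} (hl : lam * lam' = 1)
    (h : ∀ n : ℕ+, pairing ℏ k (fun i => E.coef i n) (fun i => F.coef i (-n)) n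
      = -(lam ^ (n : ℕ) / n))
    (h' : ∀ n : ℕ+, pairing ℏ k (fun i => F.coef i n) (fun i => E.coef i (-n)) n
      = -(lam' ^ (n : ℕ) / n))
    (x y : ℂ) (P : Pol) :
    oscZ ℏ k E (x - 1) (oscZ ℏ k F y P) = (-lam) • oscZ ℏ k F (y - 1) (oscZ ℏ k E x P) := by
  by_cases hx : ∃ n : ℤ, x = n
  · by_cases hy : ∃ n : ℤ, y = n
    · obtain ⟨d, rfl⟩ := hx
      obtain ⟨e, rfl⟩ := hy
      obtain ⟨w, hP⟩ := exists_mem_below P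
      have ed : (d : ℂ) - 1 = ((d - 1 : ℤ) : ℂ) := by push_cast; ring
      have ee : (e : ℂ) - 1 = ((e - 1 : ℤ) : ℂ) := by push_cast; ring
      -- Both sides combine the coefficients at (d-1, e) and (d, e-1) of the same normal-ordered
      -- product, and `hl` matches them.
      rw [ed, ee, oscZ_intCast, oscZ_intCast, oscZ_intCast, oscZ_intCast,
        oscCoeff_mul_oscCoeff h (d - 1) e hP,
        oscCoeff_mul_oscCoeff h' (e - 1) d hP, normalProd_comm ℏ k F E _ _ hP,
        normalProd_comm ℏ k F E _ _ hP, sub_add_cancel, sub_add_cancel, smul_sub, smul_smul,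
        neg_mul, hl]
      simp only [neg_smul, one_smul]
      abel
    · have hy' : ∀ n : ℤ, y ≠ n := by simpa using hy
      rw [oscZ_of_forall_ne ℏ k F hy', oscZ_of_forall_ne ℏ k F (forall_sub_one_ne hy')]; simp
  · have hx' : ∀ n : ℤ, x ≠ n := by simpa using hx
    rw [oscZ_of_forall_ne ℏ k E hx', oscZ_of_forall_ne ℏ k E (forall_sub_one_ne hx')]; simp

/-! ### Operators on the Fock space -/

theorem zeroEig_add (k : ℂ) (i : Boson) (μ ν : Charge) :
    zeroEig k i (μ + ν) = zeroEig k i μ + zeroEig k i ν := by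
  simp [zeroEig, mul_add, Finset.sum_add_distrib]

/-- The eigenvalue of `∑_i f i • i_0` on the sector of charge `μ`. -/
def zeroSum (k : ℂ) (f : Boson → ℂ) (μ : Charge) : ℂ := ∑ i, f i * zeroEig k i μ

theorem zeroSum_add (k : ℂ) (f : Boson → ℂ) (μ ν : Charge) :
    zeroSum k f (μ + ν) = zeroSum k f μ + zeroSum k f ν := by
  simp [zeroSum, zeroEig_add, mul_add, Finset.sum_add_distrib]

theorem normalExp_single (ℏ k : ℂ) (E : Exponent) (s : ℂ) (μ : Charge) (P : Pol) :
    normalExp ℏ k E s (Finsupp.single μ P) = Complex.exp (zeroSum k E.zconst μ) •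
      Finsupp.single (μ + E.charge) (oscZ ℏ k E (s - zeroSum k E.zlog μ) P) := by
  rw [normalExp, Finsupp.lsum_single]
  rfl

theorem diagOp_single (f : Charge → ℂ) (μ : Charge) (P : Pol) :
    diagOp f (Finsupp.single μ P) = f μ • Finsupp.single μ P := by
  rw [diagOp, Finsupp.lsum_single]
  rfl

theorem inSectors_single (T : Module.End ℂ Pol) (μ : Charge) (P : Pol) :
    inSectors T (Finsupp.single μ P) = Finsupp.single μ (T P) := by
  simp [inSectors]

theorem end_mul_sub (R S T : Module.End ℂ Fock) : R * (S - T) = R * S - R * T := mul_sub R S T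

theorem end_sub_mul (R S T : Module.End ℂ Fock) : (R - S) * T = R * T - S * T := sub_mul R S T

theorem end_smul_sub (a : ℂ) (R S : Module.End ℂ Fock) : a • (R - S) = a • R - a • S :=
  smul_sub a R S

theorem end_sum_commutator {ι : Type*} (s : Finset ι) (R : ι → Module.End ℂ Fock)
    (S : Module.End ℂ Fock) :
    (∑ i ∈ s, R i) * S - S * ∑ i ∈ s, R i = ∑ i ∈ s, (R i * S - S * R i) := by
  rw [Finset.sum_mul, Finset.mul_sum]
  exact (Finset.sum_sub_distrib (fun i => R i * S) fun i => S * R i).symm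

/-- `F(z) G(w) = η G(w) F(z)`. -/
def Exchange (F G : Series) (η : ℂ) : Prop := ∀ s t : ℂ, F s * G t = η • (G t * F s)

/-- Crossing the charge of the other factor produces a power of the variable from `zlog` and a
constant from `zconst`: the powers must be trivial and the constants equal. -/
theorem normalExp_comm {ℏ k : ℂ} {E F : Exponent}
    (h : ∀ n : ℕ+, pairing ℏ k (fun i => E.coef i n) (fun i => F.coef i (-n)) n = 0)
    (h' : ∀ n : ℕ+, pairing ℏ k (fun i => F.coef i n) (fun i => E.coef i (-n)) n = 0)
    (hE : zeroSum k E.zlog F.charge = 0) (hF : zeroSum k F.zlog E.charge = 0)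
    (hc : zeroSum k E.zconst F.charge = zeroSum k F.zconst E.charge) :
    Exchange (normalExp ℏ k E) (normalExp ℏ k F) 1 := by
  intro s t
  refine Finsupp.lhom_ext fun μ P => ?_
  rw [one_smul, Module.End.mul_apply, Module.End.mul_apply, normalExp_single, normalExp_single,
    map_smul, map_smul, normalExp_single, normalExp_single, smul_smul, smul_smul,
    ← Complex.exp_add, ← Complex.exp_add, zeroSum_add, zeroSum_add, zeroSum_add, zeroSum_add,
    hE, hF, hc, add_zero, add_zero, oscZ_comm h h', add_right_comm μ]
  congr 2
  ring

/-- The zero modes supply z and w, making the contractions z - λw and w - λ⁻¹z; `hc` collects their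
ratio -λ and the zero-mode constants into `η`. -/
theorem normalExp_exchange {ℏ k : ℂ} {E F : Exponent} {lam lam' η : ℂ} (hl : lam * lam' = 1)
    (h : ∀ n : ℕ+, pairing ℏ k (fun i => E.coef i n) (fun i => F.coef i (-n)) n
      = -(lam ^ (n : ℕ) / n))
    (h' : ∀ n : ℕ+, pairing ℏ k (fun i => F.coef i n) (fun i => E.coef i (-n)) n
      = -(lam' ^ (n : ℕ) / n))
    (hE : zeroSum k E.zlog F.charge = 1) (hF : zeroSum k F.zlog E.charge = 1)
    (hc : Complex.exp (zeroSum k E.zconst F.charge) * -lam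
      = η * Complex.exp (zeroSum k F.zconst E.charge)) :
    Exchange (normalExp ℏ k E) (normalExp ℏ k F) η := by
  intro s t
  refine Finsupp.lhom_ext fun μ P => ?_
  rw [LinearMap.smul_apply, Module.End.mul_apply, Module.End.mul_apply, normalExp_single,
    normalExp_single,
    map_smul, map_smul, normalExp_single, normalExp_single, smul_smul, smul_smul, smul_smul,
    zeroSum_add, zeroSum_add, zeroSum_add, zeroSum_add,
    hE, hF, ← sub_sub, ← sub_sub, oscZ_exchange hl h h', ← Finsupp.smul_single, smul_smul,
    add_right_comm μ]
  congr 1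
  rw [Complex.exp_add, Complex.exp_add]
  linear_combination (Complex.exp (zeroSum k E.zconst μ) * Complex.exp (zeroSum k F.zconst μ)) * hc

/-! ### Stability of exchange and conjugation relations under the operations that build the currents
-/

theorem Exchange.add {F G G' : Series} {η : ℂ} (h : Exchange F G η) (h' : Exchange F G' η) :
    Exchange F (G + G') η := fun s t => by
  rw [Pi.add_apply, mul_add, add_mul, h, h', smul_add]

theorem Exchange.smul {F G : Series} {η : ℂ} (h : Exchange F G η) (c : ℂ) :
    Exchange F (c • G) η := fun s t => by
  rw [Pi.smul_apply, mul_smul_comm, smul_mul_assoc, h, smul_comm]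

theorem Exchange.neg {F G : Series} {η : ℂ} (h : Exchange F G η) : Exchange F (-G) η :=
  fun s t => by
    have := h.smul (-1) s t
    rwa [show ((-1 : ℂ) • G) = -G from neg_one_smul ℂ G] at this

theorem Exchange.sub {F G G' : Series} {η : ℂ} (h : Exchange F G η) (h' : Exchange F G' η) :
    Exchange F (G - G') η := fun s t => by
  rw [Pi.sub_apply, end_mul_sub, end_sub_mul, h, h', end_smul_sub]

theorem Exchange.zmul {F G : Series} {η : ℂ} (h : Exchange F G η) (m : ℂ) :
    Exchange F (zmul m G) η := fun s _ => h s _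

/-- `T F(z) = κ F(z) T`. -/
def Conjugates (T : Module.End ℂ Fock) (F : Series) (κ : ℂ) : Prop :=
  ∀ s : ℂ, T * F s = κ • (F s * T)

theorem Exchange.rmul {F G : Series} {η : ℂ} {T : Module.End ℂ Fock} (h : Exchange F G η)
    (hT : Conjugates T F 1) : Exchange F (rmul G T) η := fun s t => by
  have hT := hT s
  rw [one_smul] at hT
  rw [QVertex.rmul, ← mul_assoc, h, smul_mul_assoc, mul_assoc, ← hT, mul_assoc]

theorem Exchange.rmul_left {F G : Series} {η κ : ℂ} {T : Module.End ℂ Fock} (h : Exchange F G η)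
    (hT : Conjugates T G κ) : Exchange (QVertex.rmul F T) G (κ * η) := fun s t => by
  rw [QVertex.rmul, mul_assoc, hT, mul_smul_comm, ← mul_assoc, h, smul_mul_assoc, smul_smul,
    mul_assoc]

theorem Conjugates.add {F F' : Series} {κ : ℂ} {T : Module.End ℂ Fock} (h : Conjugates T F κ)
    (h' : Conjugates T F' κ) : Conjugates T (F + F') κ := fun s => by
  rw [Pi.add_apply, mul_add, add_mul, h, h', smul_add]

theorem Conjugates.sub {F F' : Series} {κ : ℂ} {T : Module.End ℂ Fock} (h : Conjugates T F κ)
    (h' : Conjugates T F' κ) : Conjugates T (F - F') κ := fun s => by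
  rw [Pi.sub_apply, end_mul_sub, end_sub_mul, h, h', end_smul_sub]

theorem Conjugates.smul {F : Series} {κ : ℂ} {T : Module.End ℂ Fock} (h : Conjugates T F κ)
    (c : ℂ) : Conjugates T (c • F) κ := fun s => by
  rw [Pi.smul_apply, mul_smul_comm, smul_mul_assoc, h, smul_comm]

theorem Conjugates.zmul {F : Series} {κ : ℂ} {T : Module.End ℂ Fock} (h : Conjugates T F κ)
    (m : ℂ) : Conjugates T (zmul m F) κ := fun _ => h _

theorem Conjugates.rmul {F : Series} {κ : ℂ} {T S : Module.End ℂ Fock} (h : Conjugates T F κ)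
    (hS : Commute T S) : Conjugates T (rmul F S) κ := fun s => by
  rw [QVertex.rmul, ← mul_assoc, h, smul_mul_assoc, mul_assoc, hS.eq, mul_assoc]

theorem diagOp_commute (f g : Charge → ℂ) : Commute (diagOp f) (diagOp g) := by
  refine Finsupp.lhom_ext fun μ P => ?_
  simp only [Module.End.mul_apply, diagOp_single, map_smul, smul_smul, mul_comm]

theorem diagOp_mul (f g : Charge → ℂ) : diagOp f * diagOp g = diagOp (f * g) := by
  refine Finsupp.lhom_ext fun μ P => ?_
  simp only [Module.End.mul_apply, diagOp_single, map_smul, smul_smul, Pi.mul_apply, mul_comm]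

theorem diagOp_one : diagOp 1 = 1 := by
  refine Finsupp.lhom_ext fun μ P => ?_
  simp [diagOp_single]

/-- A normal-ordered exponential shifts every charge by the same vector, so only the behaviour of
`f` under this shift matters. -/
theorem diagOp_conjugates {ℏ k κ : ℂ} {f : Charge → ℂ} {E : Exponent}
    (h : ∀ μ, f (μ + E.charge) = κ * f μ) : Conjugates (diagOp f) (normalExp ℏ k E) κ := by
  intro s
  refine Finsupp.lhom_ext fun μ P => ?_
  rw [LinearMap.smul_apply, Module.End.mul_apply, Module.End.mul_apply, normalExp_single,
    map_smul, diagOp_single, diagOp_single, map_smul, normalExp_single, h, smul_smul, smul_smul,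
    smul_smul]
  congr 1
  ring

theorem signOp_conjugates {ℏ k κ : ℂ} {L : Finset Boson} {E : Exponent}
    (h : Complex.exp (Complex.I * Real.pi * ∑ i ∈ L, zeroEig k i E.charge) = κ) :
    Conjugates (signOp k L) (normalExp ℏ k E) κ :=
  diagOp_conjugates fun μ => by
    simp only [zeroEig_add, Finset.sum_add_distrib, mul_add, Complex.exp_add, ← h]
    ring

theorem signOpInv_conjugates {ℏ k κ : ℂ} {L : Finset Boson} {E : Exponent}
    (h : Complex.exp (-(Complex.I * Real.pi * ∑ i ∈ L, zeroEig k i E.charge)) = κ) :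
    Conjugates (signOpInv k L) (normalExp ℏ k E) κ :=
  diagOp_conjugates fun μ => by
    simp only [zeroEig_add, Finset.sum_add_distrib, mul_add, neg_add, Complex.exp_add, ← h]
    ring

theorem exp_pi_mul_two_mul_int (m : ℤ) : Complex.exp (Complex.I * Real.pi * (2 * m)) = 1 := by
  rw [← Complex.exp_int_mul_two_pi_mul_I m]
  ring_nf

theorem signOp_conjugates_even {ℏ k : ℂ} {L : Finset Boson} {E : Exponent} (m : ℤ)
    (h : ∑ i ∈ L, zeroEig k i E.charge = 2 * m) :
    Conjugates (signOp k L) (normalExp ℏ k E) 1 :=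
  signOp_conjugates (by rw [h, exp_pi_mul_two_mul_int])

theorem signOp_conjugates_odd {ℏ k : ℂ} {L : Finset Boson} {E : Exponent} (m : ℤ)
    (h : ∑ i ∈ L, zeroEig k i E.charge = 2 * m + 1) :
    Conjugates (signOp k L) (normalExp ℏ k E) (-1) :=
  signOp_conjugates (by
    rw [h, mul_add, Complex.exp_add, exp_pi_mul_two_mul_int, mul_one, one_mul, mul_comm,
      Complex.exp_pi_mul_I])

theorem signOpInv_conjugates_even {ℏ k : ℂ} {L : Finset Boson} {E : Exponent} (m : ℤ)
    (h : ∑ i ∈ L, zeroEig k i E.charge = 2 * m) :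
    Conjugates (signOpInv k L) (normalExp ℏ k E) 1 :=
  signOpInv_conjugates (by rw [h, Complex.exp_neg, exp_pi_mul_two_mul_int, inv_one])

/-! ### Commutators with the oscillators -/

theorem osc_pos (ℏ k : ℂ) (i : Boson) (n : ℕ+) :
    osc ℏ k i (n : ℕ) = inSectors (annihPol ℏ k i n) := by
  rw [osc, dif_pos (by exact_mod_cast n.pos)]
  rfl

theorem osc_neg (ℏ k : ℂ) (i : Boson) (n : ℕ+) :
    osc ℏ k i (-(n : ℕ)) = inSectors (LinearMap.mulLeft ℂ (MvPolynomial.X (i, n))) := by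
  have := n.pos
  rw [osc, dif_neg (by omega), dif_pos (by omega)]
  have h : (⟨(- -((n : ℕ) : ℤ)).toNat, by omega⟩ : ℕ+) = n := PNat.eq (by
    change (- -((n : ℕ) : ℤ)).toNat = n
    omega)
  exact congrArg (fun m => inSectors (LinearMap.mulLeft ℂ (MvPolynomial.X (i, m)))) h

theorem forall_sub_natCast_ne {x : ℂ} (h : ∀ n : ℤ, x ≠ n) (m : ℤ) (n : ℤ) : x - m ≠ n := fun h' =>
  h (n + m) (by push_cast; linear_combination h')

theorem annihPol_oscZ (ℏ k : ℂ) (E : Exponent) (i : Boson) (n : ℕ+) (x : ℂ) (P : Pol) :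
    annihPol ℏ k i n (oscZ ℏ k E x P) = oscZ ℏ k E x (annihPol ℏ k i n P)
      + (∑ j, oscComm ℏ k i j n * E.coef j (-n)) • oscZ ℏ k E (x - (n : ℕ)) P := by
  by_cases hx : ∃ n : ℤ, x = n
  · obtain ⟨d, rfl⟩ := hx
    have e : (d : ℂ) - ((n : ℕ) : ℂ) = ((d - (n : ℕ) : ℤ) : ℂ) := by push_cast; ring
    rw [e, oscZ_intCast, oscZ_intCast, annihPol_oscCoeff]
  · have hx' : ∀ n : ℤ, x ≠ n := by simpa using hx
    have h2 := oscZ_of_forall_ne ℏ k E (forall_sub_natCast_ne hx' (n : ℕ))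
    push_cast at h2
    rw [oscZ_of_forall_ne ℏ k E hx', h2]
    simp

theorem X_mul_oscZ (ℏ k : ℂ) (E : Exponent) (i : Boson) (n : ℕ+) (x : ℂ) (P : Pol) :
    MvPolynomial.X (i, n) * oscZ ℏ k E x P = oscZ ℏ k E x (MvPolynomial.X (i, n) * P)
      - (∑ j, E.coef j n * oscComm ℏ k j i n) • oscZ ℏ k E (x + (n : ℕ)) P := by
  by_cases hx : ∃ n : ℤ, x = n
  · obtain ⟨d, rfl⟩ := hx
    have e : (d : ℂ) + ((n : ℕ) : ℂ) = ((d + (n : ℕ) : ℤ) : ℂ) := by push_cast; ring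
    rw [e, oscZ_intCast, oscZ_intCast, oscCoeff_mul_X]
    abel
  · have hx' : ∀ n : ℤ, x ≠ n := by simpa using hx
    have h2 := oscZ_of_forall_ne ℏ k E (forall_sub_natCast_ne hx' (-(n : ℕ)))
    push_cast at h2
    rw [sub_neg_eq_add] at h2
    rw [oscZ_of_forall_ne ℏ k E hx', h2]
    simp

theorem osc_pos_normalExp (ℏ k : ℂ) (E : Exponent) (i : Boson) (n : ℕ+) (s : ℂ) :
    osc ℏ k i (n : ℕ) * normalExp ℏ k E s - normalExp ℏ k E s * osc ℏ k i (n : ℕ)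
      = (∑ j, oscComm ℏ k i j n * E.coef j (-n)) • normalExp ℏ k E (s - (n : ℕ)) := by
  refine Finsupp.lhom_ext fun μ P => ?_
  rw [osc_pos, LinearMap.sub_apply, Module.End.mul_apply, Module.End.mul_apply,
    LinearMap.smul_apply, normalExp_single, inSectors_single, map_smul, inSectors_single,
    normalExp_single, normalExp_single, annihPol_oscZ, Finsupp.single_add, smul_add,
    add_sub_cancel_left, ← Finsupp.smul_single, smul_comm, sub_right_comm]

theorem osc_neg_normalExp (ℏ k : ℂ) (E : Exponent) (i : Boson) (n : ℕ+) (s : ℂ) :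
    osc ℏ k i (-(n : ℕ)) * normalExp ℏ k E s - normalExp ℏ k E s * osc ℏ k i (-(n : ℕ))
      = (-∑ j, E.coef j n * oscComm ℏ k j i n) • normalExp ℏ k E (s + (n : ℕ)) := by
  refine Finsupp.lhom_ext fun μ P => ?_
  rw [osc_neg, LinearMap.sub_apply, Module.End.mul_apply, Module.End.mul_apply,
    LinearMap.smul_apply, normalExp_single, inSectors_single, map_smul, inSectors_single,
    normalExp_single, normalExp_single, LinearMap.mulLeft_apply, LinearMap.mulLeft_apply,
    X_mul_oscZ, Finsupp.single_sub, smul_sub,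
    sub_sub_cancel_left, ← Finsupp.smul_single, smul_comm, add_sub_right_comm, neg_smul]

theorem sum_osc_pos_normalExp (ℏ k : ℂ) (v : Boson → ℂ) (E : Exponent) (n : ℕ+) (s : ℂ) :
    (∑ i, v i • osc ℏ k i (n : ℕ)) * normalExp ℏ k E s
        - normalExp ℏ k E s * ∑ i, v i • osc ℏ k i (n : ℕ)
      = pairing ℏ k v (fun i => E.coef i (-n)) n • normalExp ℏ k E (s - (n : ℕ)) := by
  rw [end_sum_commutator, pairing, Finset.sum_smul]
  refine Finset.sum_congr rfl fun i _ => ?_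
  rw [smul_mul_assoc, mul_smul_comm, ← end_smul_sub, osc_pos_normalExp, smul_smul, Finset.mul_sum]
  congr 1
  exact Finset.sum_congr rfl fun j _ => by ring

theorem sum_osc_neg_normalExp (ℏ k : ℂ) (v : Boson → ℂ) (E : Exponent) (n : ℕ+) (s : ℂ) :
    (∑ i, v i • osc ℏ k i (-(n : ℕ))) * normalExp ℏ k E s
        - normalExp ℏ k E s * ∑ i, v i • osc ℏ k i (-(n : ℕ))
      = (-pairing ℏ k (fun i => E.coef i n) v n) • normalExp ℏ k E (s + (n : ℕ)) := by
  rw [end_sum_commutator, pairing, Finset.sum_comm,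
    ← Finset.sum_neg_distrib, Finset.sum_smul]
  refine Finset.sum_congr rfl fun i _ => ?_
  rw [smul_mul_assoc, mul_smul_comm, ← end_smul_sub, osc_neg_normalExp, smul_smul, mul_neg,
    Finset.mul_sum]
  congr 2
  exact Finset.sum_congr rfl fun j _ => by ring

theorem osc_commute_signOp (ℏ k : ℂ) (i : Boson) (n : ℤ) (L : Finset Boson) :
    Commute (osc ℏ k i n) (signOp k L) := by
  have h : ∀ (T : Module.End ℂ Pol) f, Commute (inSectors T) (diagOp f) := fun T f => by
    refine Finsupp.lhom_ext fun μ P => ?_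
    simp only [Module.End.mul_apply, diagOp_single, inSectors_single, map_smul]
  unfold osc
  split_ifs
  · exact h _ _
  · exact h _ _
  · exact diagOp_commute _ _

/-! ### Contractions -/

theorem sum_boson {M : Type*} [AddCommMonoid M] (f : Boson → M) :
    ∑ i, f i = f a1 + (f a2 + (f b12 + (f b13 + (f b23 + f c)))) := by
  change ∑ i ∈ {a1, a2, b12, b13, b23, c}, f i = _
  rw [Finset.sum_insert (by decide), Finset.sum_insert (by decide), Finset.sum_insert (by decide),
    Finset.sum_insert (by decide), Finset.sum_insert (by decide), Finset.sum_singleton]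

/-! ### Powers of q and q-numbers -/

theorem qpow_add (ℏ x y : ℂ) : qpow ℏ (x + y) = qpow ℏ x * qpow ℏ y := by
  rw [qpow, add_mul, Complex.exp_add, qpow, qpow]

theorem qpow_eq_mul {ℏ x a b c : ℂ} (h : x = a + b + c) :
    qpow ℏ x = qpow ℏ a * qpow ℏ b * qpow ℏ c := by
  rw [h, qpow_add, qpow_add]

theorem qpow_pow (ℏ x : ℂ) (n : ℕ) : qpow ℏ x ^ n = qpow ℏ (x * n) := by
  rw [qpow, qpow, ← Complex.exp_nat_mul]
  ring_nf

theorem qnum_neg (ℏ x : ℂ) : qnum ℏ (-x) = -qnum ℏ x := by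
  rw [qnum, qnum, neg_neg, ← neg_div, neg_sub]

/-- `q - q⁻¹`. -/
def qdiff (ℏ : ℂ) : ℂ := qpow ℏ 1 - qpow ℏ (-1)

theorem qnum_eq (ℏ x : ℂ) : qnum ℏ x = (qpow ℏ x - qpow ℏ (-x)) / qdiff ℏ := rfl

@[simp]
theorem qpow_zero (ℏ : ℂ) : qpow ℏ 0 = 1 := by simp [qpow]

theorem qpow_sub_ne_zero {ℏ : ℂ} (hq : ∀ n : ℕ, 0 < n → qpow ℏ n ≠ 1) (n : ℕ) (hn : 0 < n) :
    qpow ℏ n - qpow ℏ (-n) ≠ 0 := by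
  intro h
  -- `q^n = q^(-n)` would force `q^(2n) = 1`.
  refine hq (n + n) (by omega) ?_
  push_cast
  rw [qpow_add]
  nth_rewrite 2 [sub_eq_zero.1 h]
  rw [← qpow_add, add_neg_cancel, qpow, zero_mul, Complex.exp_zero]

theorem qdiff_ne_zero {ℏ : ℂ} (hq : ∀ n : ℕ, 0 < n → qpow ℏ n ≠ 1) : qdiff ℏ ≠ 0 := by
  simpa [qdiff] using qpow_sub_ne_zero hq 1 one_pos

theorem qnum_natCast_ne_zero {ℏ : ℂ} (hq : ∀ n : ℕ, 0 < n → qpow ℏ n ≠ 1) (n : ℕ) (hn : 0 < n) :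
    qnum ℏ n ≠ 0 :=
  div_ne_zero (qpow_sub_ne_zero hq n hn) (qdiff_ne_zero hq)

/-- The oscillator coefficients of `E` are those of
`∑_{m ≠ 0} (x_m D_m + y_m b¹³_m + z_m b²³_m) / [m]`, `D_m = a¹_m + [2m]/[m] a²_m`. -/
structure Shape (ℏ : ℂ) (E : Exponent) (x y z : ℤ → ℂ) : Prop where
  coef_a1 : ∀ m ≠ 0, E.coef a1 m = x m / qnum ℏ m
  coef_a2 : ∀ m ≠ 0, E.coef a2 m = qnum ℏ (2 * m) / qnum ℏ m * (x m / qnum ℏ m)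
  coef_b12 : ∀ m ≠ 0, E.coef b12 m = 0
  coef_b13 : ∀ m ≠ 0, E.coef b13 m = y m / qnum ℏ m
  coef_b23 : ∀ m ≠ 0, E.coef b23 m = z m / qnum ℏ m
  coef_c : ∀ m ≠ 0, E.coef c m = 0

/-- D_m is built to commute with a¹, and the a² oscillators commute among themselves; so of the
a-part of `w` only the a² coefficient survives, through [D_n, a²_{-n}] = -[n][(k+1)n]/n. -/
theorem Shape.pairing_pos {ℏ k : ℂ} {E : Exponent} {x y z : ℤ → ℂ} (h : Shape ℏ E x y z) {n : ℕ+}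
    (hn : qnum ℏ (n : ℕ) ≠ 0) (w : Boson → ℂ) :
    pairing ℏ k (fun i => E.coef i n) w n
      = ((y n * w b13 + z n * w b23) * qnum ℏ (n : ℕ) - x n * w a2 * qnum ℏ ((k + 1) * (n : ℕ)))
        / (n : ℕ) := by
  have hn0 : ((n : ℕ) : ℤ) ≠ 0 := by exact_mod_cast n.ne_zero
  have hnc : ((n : ℕ) : ℂ) ≠ 0 := by exact_mod_cast n.ne_zero
  simp only [pairing, sum_boson, oscComm, h.coef_a1 _ hn0, h.coef_a2 _ hn0, h.coef_b12 _ hn0,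
    h.coef_b13 _ hn0, h.coef_b23 _ hn0, h.coef_c _ hn0, qnum_neg, Int.cast_natCast]
  field_simp
  ring

theorem Shape.pairing_neg {ℏ k : ℂ} {E : Exponent} {x y z : ℤ → ℂ} (h : Shape ℏ E x y z) {n : ℕ+}
    (hn : qnum ℏ (n : ℕ) ≠ 0) (w : Boson → ℂ) :
    pairing ℏ k w (fun i => E.coef i (-n)) n
      = -(((y (-n) * w b13 + z (-n) * w b23) * qnum ℏ (n : ℕ)
        - x (-n) * w a2 * qnum ℏ ((k + 1) * (n : ℕ))) / (n : ℕ)) := by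
  have hn0 : -((n : ℕ) : ℤ) ≠ 0 := by have := n.ne_zero; omega
  have hnc : ((n : ℕ) : ℂ) ≠ 0 := by exact_mod_cast n.ne_zero
  simp only [pairing, sum_boson, oscComm, h.coef_a1 _ hn0, h.coef_a2 _ hn0, h.coef_b12 _ hn0,
    h.coef_b13 _ hn0, h.coef_b23 _ hn0, h.coef_c _ hn0, qnum_neg, Int.cast_natCast, Int.cast_neg,
    mul_neg]
  field_simp
  ring

theorem Shape.comm {ℏ k : ℂ} (hq : ∀ n : ℕ, 0 < n → qpow ℏ n ≠ 1) {E F : Exponent} {x y z : ℤ → ℂ}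
    (h : Shape ℏ E x y z)
    (hpos : ∀ n : ℕ+, (y n * F.coef b13 (-n) + z n * F.coef b23 (-n)) * qnum ℏ (n : ℕ)
      = x n * F.coef a2 (-n) * qnum ℏ ((k + 1) * (n : ℕ)))
    (hneg : ∀ n : ℕ+, (y (-n) * F.coef b13 n + z (-n) * F.coef b23 n) * qnum ℏ (n : ℕ)
      = x (-n) * F.coef a2 n * qnum ℏ ((k + 1) * (n : ℕ)))
    (hE : zeroSum k E.zlog F.charge = 0) (hF : zeroSum k F.zlog E.charge = 0)
    (hc : zeroSum k E.zconst F.charge = zeroSum k F.zconst E.charge) :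
    Exchange (normalExp ℏ k E) (normalExp ℏ k F) 1 :=
  normalExp_comm
    (fun n => by rw [h.pairing_pos (qnum_natCast_ne_zero hq n n.pos), hpos, sub_self, zero_div])
    (fun n => by
      rw [h.pairing_neg (qnum_natCast_ne_zero hq n n.pos), hneg, sub_self, zero_div, neg_zero])
    hE hF hc

/-- The contraction ratios are λ = q^l and λ⁻¹ = q^{-l}. By `hc` the zero-mode constants absorb the
factor q^l, leaving exactly -1. -/
theorem Shape.exchange {ℏ k : ℂ} (hq : ∀ n : ℕ, 0 < n → qpow ℏ n ≠ 1) {E F : Exponent}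
    {x y z : ℤ → ℂ} (h : Shape ℏ E x y z) (l : ℂ)
    (hpos : ∀ n : ℕ+, (y n * F.coef b13 (-n) + z n * F.coef b23 (-n)) * qnum ℏ (n : ℕ)
      - x n * F.coef a2 (-n) * qnum ℏ ((k + 1) * (n : ℕ)) = -qpow ℏ (l * (n : ℕ)))
    (hneg : ∀ n : ℕ+, (y (-n) * F.coef b13 n + z (-n) * F.coef b23 n) * qnum ℏ (n : ℕ)
      - x (-n) * F.coef a2 n * qnum ℏ ((k + 1) * (n : ℕ)) = qpow ℏ (-l * (n : ℕ)))
    (hE : zeroSum k E.zlog F.charge = 1) (hF : zeroSum k F.zlog E.charge = 1)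
    (hc : zeroSum k E.zconst F.charge + l * ℏ = zeroSum k F.zconst E.charge) :
    Exchange (normalExp ℏ k E) (normalExp ℏ k F) (-1) :=
  normalExp_exchange (lam := qpow ℏ l) (lam' := qpow ℏ (-l)) (by simp [← qpow_add])
    (fun n => by
      rw [h.pairing_pos (qnum_natCast_ne_zero hq n n.pos), hpos, qpow_pow, neg_div])
    (fun n => by rw [h.pairing_neg (qnum_natCast_ne_zero hq n n.pos), hneg, qpow_pow])
    hE hF (by rw [← hc, Complex.exp_add, qpow]; ring)

theorem zeroSum_eq (k : ℂ) (f : Boson → ℂ) (μ : Charge) :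
    zeroSum k f μ = (k + 1) * (f a1 * (2 * μ a1 - μ a2) - f a2 * μ a1) - f b12 * μ b12
      + f b13 * μ b13 + f b23 * μ b23 + f c * μ c := by
  simp only [zeroSum, zeroEig, sum_boson, zeroComm]
  ring

/-! ### The exponents of the elementary vertex operators -/

@[simp] theorem Exponent.add_coef (E F : Exponent) (i : Boson) (n : ℤ) :
    (E + F).coef i n = E.coef i n + F.coef i n := rfl

@[simp] theorem Exponent.neg_coef (E : Exponent) (i : Boson) (n : ℤ) :
    (-E).coef i n = -E.coef i n := rfl

@[simp] theorem Exponent.sub_coef (E F : Exponent) (i : Boson) (n : ℤ) :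
    (E - F).coef i n = E.coef i n - F.coef i n := (sub_eq_add_neg _ _).symm

@[simp] theorem Exponent.add_charge (E F : Exponent) (i : Boson) :
    (E + F).charge i = E.charge i + F.charge i := rfl

@[simp] theorem Exponent.neg_charge (E : Exponent) (i : Boson) :
    (-E).charge i = -E.charge i := rfl

@[simp] theorem Exponent.sub_charge (E F : Exponent) (i : Boson) :
    (E - F).charge i = E.charge i - F.charge i := (sub_eq_add_neg _ _).symm

@[simp] theorem Exponent.add_zlog (E F : Exponent) (i : Boson) :
    (E + F).zlog i = E.zlog i + F.zlog i := rfl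

@[simp] theorem Exponent.neg_zlog (E : Exponent) (i : Boson) : (-E).zlog i = -E.zlog i := rfl

@[simp] theorem Exponent.sub_zlog (E F : Exponent) (i : Boson) :
    (E - F).zlog i = E.zlog i - F.zlog i := (sub_eq_add_neg _ _).symm

@[simp] theorem Exponent.add_zconst (E F : Exponent) (i : Boson) :
    (E + F).zconst i = E.zconst i + F.zconst i := rfl

@[simp] theorem Exponent.neg_zconst (E : Exponent) (i : Boson) :
    (-E).zconst i = -E.zconst i := rfl

@[simp] theorem Exponent.sub_zconst (E F : Exponent) (i : Boson) :
    (E - F).zconst i = E.zconst i - F.zconst i := (sub_eq_add_neg _ _).symm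

/-- In this and the next three lemmas the power of q has three sources: the coefficients of the
combination, the factor q^{-κ|m|} of the field, and the rescaled argument, which gives the part
linear in `m`. -/
theorem shape_phi4 (ℏ α : ℂ) : Shape ℏ (-field ℏ (Astar ℏ) (α + 1) (-α / 2))
    (fun m => -qpow ℏ ((1 / 2 + α / 2) * (|m| : ℤ) - (α + 1) * m)) 0 0 where
  coef_a1 m hm := by
    simp only [Exponent.neg_coef, field, Astar, sub_eq_add_neg, add_mul, qpow_add]
    ring_nf
  coef_a2 m hm := by
    simp only [Exponent.neg_coef, field, Astar, sub_eq_add_neg, add_mul, qpow_add, ratioTwo,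
      if_neg hm]
    ring_nf
  coef_b12 m hm := by simp [field, Astar]
  coef_b13 m hm := by simp [field, Astar]
  coef_b23 m hm := by simp [field, Astar]
  coef_c m hm := by simp [field, Astar]

theorem shape_phiStar1 (ℏ α : ℂ) : Shape ℏ (field ℏ (Bstar ℏ α) α (-α / 2))
    (fun m => ratioAlpha ℏ α m * qpow ℏ ((1 / 2 + α / 2) * (|m| : ℤ) - α * m)) 0 0 where
  coef_a1 m hm := by
    simp only [field, Bstar, sub_eq_add_neg, add_mul, qpow_add]
    ring_nf
  coef_a2 m hm := by
    simp only [field, Bstar, sub_eq_add_neg, add_mul, qpow_add, ratioTwo, if_neg hm]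
    ring_nf
  coef_b12 m hm := by simp [field, Bstar]
  coef_b13 m hm := by simp [field, Bstar]
  coef_b23 m hm := by simp [field, Bstar]
  coef_c m hm := by simp [field, Bstar]

theorem shape_psi1 (ℏ α : ℂ) : Shape ℏ (-field ℏ (BtildeStar ℏ α) α (α / 2))
    (fun m => -qpow ℏ (-(1 / 2 + α / 2) * (|m| : ℤ) - α * m))
    (fun m => qpow ℏ (-α * (|m| : ℤ) - α * m))
    (fun m => qpow ℏ (-(1 + α) * (|m| : ℤ) - α * m)) where
  coef_a1 m hm := by
    simp only [Exponent.neg_coef, field, BtildeStar]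
    rw [qpow_eq_mul (x := -(1 / 2 + α / 2) * (|m| : ℤ) - α * m)
      (a := -(|m| : ℤ) / 2) (b := -(α / 2) * (|m| : ℤ)) (c := -α * m) (by ring)]
    ring
  coef_a2 m hm := by
    simp only [Exponent.neg_coef, field, BtildeStar, ratioTwo, if_neg hm]
    rw [qpow_eq_mul (x := -(1 / 2 + α / 2) * (|m| : ℤ) - α * m)
      (a := -(|m| : ℤ) / 2) (b := -(α / 2) * (|m| : ℤ)) (c := -α * m) (by ring)]
    ring
  coef_b12 m hm := by simp [field, BtildeStar]
  coef_b13 m hm := by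
    simp only [Exponent.neg_coef, field, BtildeStar]
    rw [qpow_eq_mul (x := -α * (|m| : ℤ) - α * m)
      (a := -(α / 2) * (|m| : ℤ)) (b := -(α / 2) * (|m| : ℤ)) (c := -α * m) (by ring)]
    ring
  coef_b23 m hm := by
    simp only [Exponent.neg_coef, field, BtildeStar]
    rw [qpow_eq_mul (x := -(1 + α) * (|m| : ℤ) - α * m)
      (a := -(|m| : ℤ) + -(α / 2) * (|m| : ℤ)) (b := -(α / 2) * (|m| : ℤ))
      (c := -α * m) (by ring), qpow_add]
    ring
  coef_c m hm := by simp [field, BtildeStar]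

theorem shape_psiStar4 (ℏ α : ℂ) : Shape ℏ (field ℏ (AtildeStar ℏ α) (α - 1) (α / 2))
    (fun m => ratioAlpha ℏ α m * qpow ℏ (-(1 / 2 + α / 2) * (|m| : ℤ) - (α - 1) * m))
    (fun m => qpow ℏ ((1 + α) * (|m| : ℤ) - (α - 1) * m))
    (fun m => qpow ℏ (α * (|m| : ℤ) - (α - 1) * m)) where
  coef_a1 m hm := by
    simp only [field, AtildeStar]
    rw [qpow_eq_mul (x := -(1 / 2 + α / 2) * (|m| : ℤ) - (α - 1) * m)
      (a := -(|m| : ℤ) / 2) (b := -(α / 2) * (|m| : ℤ)) (c := -(α - 1) * m) (by ring)]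
    ring
  coef_a2 m hm := by
    simp only [field, AtildeStar, ratioTwo, if_neg hm]
    rw [qpow_eq_mul (x := -(1 / 2 + α / 2) * (|m| : ℤ) - (α - 1) * m)
      (a := -(|m| : ℤ) / 2) (b := -(α / 2) * (|m| : ℤ)) (c := -(α - 1) * m) (by ring)]
    ring
  coef_b12 m hm := by simp [field, AtildeStar]
  coef_b13 m hm := by
    simp only [field, AtildeStar]
    rw [qpow_eq_mul (x := (1 + α) * (|m| : ℤ) - (α - 1) * m)
      (a := (|m| : ℤ) + 3 * α / 2 * (|m| : ℤ)) (b := -(α / 2) * (|m| : ℤ))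
      (c := -(α - 1) * m) (by ring), qpow_add]
    ring
  coef_b23 m hm := by
    simp only [field, AtildeStar]
    rw [qpow_eq_mul (x := α * (|m| : ℤ) - (α - 1) * m)
      (a := 3 * α / 2 * (|m| : ℤ)) (b := -(α / 2) * (|m| : ℤ)) (c := -(α - 1) * m)
      (by ring)]
    ring
  coef_c m hm := by simp [field, AtildeStar]

/-! ### Evaluation of the coefficients of the currents -/

theorem fld_coef_pos (ℏ : ℂ) (i j : Boson) (x κ : ℂ) (n : ℕ+) :
    (fld ℏ i x κ).coef j ((n : ℕ) : ℤ)
      = if j = i then -(qpow ℏ (-(κ + x) * (n : ℕ)) / qnum ℏ (n : ℕ)) else 0 := by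
  simp only [fld, field, single]
  split_ifs
  · rw [neg_add, add_mul, qpow_add]
    simp
    ring
  · simp

theorem fld_coef_neg (ℏ : ℂ) (i j : Boson) (x κ : ℂ) (n : ℕ+) :
    (fld ℏ i x κ).coef j (-((n : ℕ) : ℤ))
      = if j = i then qpow ℏ ((x - κ) * (n : ℕ)) / qnum ℏ (n : ℕ) else 0 := by
  simp only [fld, field, single]
  split_ifs
  · rw [sub_mul, sub_eq_add_neg, qpow_add]
    simp [qnum_neg, div_neg]
    ring
  · simp

theorem plus_coef_pos (ℏ : ℂ) (i j : Boson) (x : ℂ) (n : ℕ+) :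
    (plus ℏ i x).coef j ((n : ℕ) : ℤ)
      = if j = i then qdiff ℏ * qpow ℏ (-x * (n : ℕ)) else 0 := by
  simp [plus, qdiff]

theorem plus_coef_neg (ℏ : ℂ) (i j : Boson) (x : ℂ) (n : ℕ+) :
    (plus ℏ i x).coef j (-((n : ℕ) : ℤ)) = 0 := by
  simp [plus]

theorem minus_coef_pos (ℏ : ℂ) (i j : Boson) (x : ℂ) (n : ℕ+) :
    (minus ℏ i x).coef j ((n : ℕ) : ℤ) = 0 := by
  simp [minus]

theorem minus_coef_neg (ℏ : ℂ) (i j : Boson) (x : ℂ) (n : ℕ+) :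
    (minus ℏ i x).coef j (-((n : ℕ) : ℤ))
      = if j = i then -(qdiff ℏ * qpow ℏ (x * (n : ℕ))) else 0 := by
  split_ifs with h
  · simp [minus, qdiff, h]
    ring
  · simp [minus, h]

theorem ratioAlpha_pos (ℏ α : ℂ) (n : ℕ+) :
    ratioAlpha ℏ α (n : ℕ) = qnum ℏ (α * (n : ℕ)) / qnum ℏ ((α + 1) * (n : ℕ)) := by
  rw [ratioAlpha, if_neg (by exact_mod_cast n.ne_zero), Int.cast_natCast]

theorem ratioAlpha_neg (ℏ α : ℂ) (n : ℕ+) :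
    ratioAlpha ℏ α (-(n : ℕ)) = qnum ℏ (α * (n : ℕ)) / qnum ℏ ((α + 1) * (n : ℕ)) := by
  have := n.ne_zero
  rw [ratioAlpha, if_neg (by omega)]
  push_cast
  rw [mul_neg, mul_neg, qnum_neg, qnum_neg, neg_div_neg_eq]

/-! ### Exchange of ψ₁ and ψ*₄ with the lowering currents -/

set_option linter.unusedSimpArgs false

/-- X^{-,1} contains a¹ but not a², so D contributes nothing; the b¹³ and b²³ contributions cancel
because their coefficients satisfy y_m = q^{|m|} z_m. -/
theorem psi1Bare_Xm1 {ℏ α : ℂ} (hq : ∀ n : ℕ, 0 < n → qpow ℏ n ≠ 1) (hα' : α ≠ -1) :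
    Exchange (psi1Bare ℏ α) (Xm1 ℏ α) 1 := by
  have hd := qdiff_ne_zero hq
  have hα : α + 1 ≠ 0 := fun h => hα' (eq_neg_of_add_eq_zero_left h)
  have hn : ∀ n : ℕ+, qnum ℏ (n : ℕ) ≠ 0 := fun n => qnum_natCast_ne_zero hq n n.pos
  unfold psi1Bare Xm1
  have h F := (shape_psi1 ℏ α).comm hq (k := α) (F := F)
  -- The sign factors of the current see only total charges of ψ₁: 0 for `c`, `b12` and -2 for
  -- `b13`, `b23`. Both are even, so no sign arises.
  refine ((((Exchange.sub (h _ ?_ ?_ ?_ ?_ ?_) (h _ ?_ ?_ ?_ ?_ ?_)).rmul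
    (signOpInv_conjugates_even 0 ?_)).zmul _).smul _).add
    (((h _ ?_ ?_ ?_ ?_ ?_).rmul (signOp_conjugates_even (-1) ?_)).smul _)
  -- Oscillator goals become identities between exponentials once the q-numbers are expanded; the
  -- remaining goals are zero-mode equations.
  all_goals first
    | (intro n
       have hn := hn n
       simp only [Exponent.add_coef, Exponent.sub_coef, Exponent.neg_coef, fld_coef_pos,
         fld_coef_neg,
         plus_coef_pos, plus_coef_neg, minus_coef_pos, minus_coef_neg, reduceCtorEq, if_true,
         if_false, abs_neg, Nat.abs_cast, Int.cast_neg, Int.cast_natCast, add_zero, zero_add,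
         sub_zero,
         zero_sub, mul_zero, zero_mul, neg_zero]
       try field_simp
       try simp only [qnum_eq]
       try field_simp
       try simp only [qpow, mul_sub, sub_mul, mul_add, add_mul, neg_mul, mul_neg, ← Complex.exp_add]
       try ring_nf
       done)
    | (simp [zeroSum_eq, zeroEig, sum_boson, zeroComm, field, BtildeStar, fld, plus, minus, single,
         ratioTwo, ratioAlpha]
       done)
    | (simp [zeroSum_eq, zeroEig, sum_boson, zeroComm, field, BtildeStar, fld, plus, minus, single,
         ratioTwo, ratioAlpha]
       field_simp
       ring)

/-- All four exponentials contract with ratio q^{-α}. Where a²_± contributes, (q - q⁻¹)[(α+1)n] is a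
difference of two powers of q: one cancels the b-contribution, the other is the required geometric
term. -/
theorem psi1Bare_Xm2 {ℏ α : ℂ} (hq : ∀ n : ℕ, 0 < n → qpow ℏ n ≠ 1) (hα' : α ≠ -1) :
    Exchange (psi1Bare ℏ α) (Xm2 ℏ α) (-1) := by
  have hd := qdiff_ne_zero hq
  have hα : α + 1 ≠ 0 := fun h => hα' (eq_neg_of_add_eq_zero_left h)
  have hn : ∀ n : ℕ+, qnum ℏ (n : ℕ) ≠ 0 := fun n => qnum_natCast_ne_zero hq n n.pos
  unfold psi1Bare Xm2
  have h F l := (shape_psi1 ℏ α).exchange hq (k := α) (F := F) l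
  refine ((((((Exchange.sub (h _ (-α) ?_ ?_ ?_ ?_ ?_) (h _ (-α) ?_ ?_ ?_ ?_ ?_)).rmul
    (signOpInv_conjugates_even (-1) ?_)).smul _).sub
    (Exchange.sub (h _ (-α) ?_ ?_ ?_ ?_ ?_) (h _ (-α) ?_ ?_ ?_ ?_ ?_))).zmul _).smul _)
  all_goals first
    | (intro n
       have hn := hn n
       simp only [Exponent.add_coef, Exponent.sub_coef, Exponent.neg_coef, fld_coef_pos,
         fld_coef_neg,
         plus_coef_pos, plus_coef_neg, minus_coef_pos, minus_coef_neg, reduceCtorEq, if_true,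
         if_false, abs_neg, Nat.abs_cast, Int.cast_neg, Int.cast_natCast, add_zero, zero_add,
         sub_zero,
         zero_sub, mul_zero, zero_mul, neg_zero]
       try field_simp
       try simp only [qnum_eq]
       try field_simp
       try simp only [qpow, mul_sub, sub_mul, mul_add, add_mul, neg_mul, mul_neg, ← Complex.exp_add]
       try ring_nf
       done)
    | (simp [zeroSum_eq, zeroEig, sum_boson, zeroComm, field, BtildeStar, fld, plus, minus, single,
         ratioTwo, ratioAlpha]
       done)
    | (simp [zeroSum_eq, zeroEig, sum_boson, zeroComm, field, BtildeStar, fld, plus, minus, single,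
         ratioTwo, ratioAlpha]
       field_simp
       ring)

/-- `ψ*₄` without its sign factor. -/
def psiStar4Bare (ℏ α : ℂ) : Series := normalExp ℏ α (field ℏ (AtildeStar ℏ α) (α - 1) (α / 2))

theorem psiStar4Bare_Xm1 {ℏ α : ℂ} (hq : ∀ n : ℕ, 0 < n → qpow ℏ n ≠ 1) (hα' : α ≠ -1)
    (hgen : ∀ n : ℕ, 0 < n → qnum ℏ ((α + 1) * n) ≠ 0) :
    Exchange (psiStar4Bare ℏ α) (Xm1 ℏ α) 1 := by
  have hd := qdiff_ne_zero hq
  have hα : α + 1 ≠ 0 := fun h => hα' (eq_neg_of_add_eq_zero_left h)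
  have hn : ∀ n : ℕ+, qnum ℏ (n : ℕ) ≠ 0 := fun n => qnum_natCast_ne_zero hq n n.pos
  unfold psiStar4Bare Xm1
  have h F := (shape_psiStar4 ℏ α).comm hq (k := α) (F := F)
  refine ((((Exchange.sub (h _ ?_ ?_ ?_ ?_ ?_) (h _ ?_ ?_ ?_ ?_ ?_)).rmul
    (signOpInv_conjugates_even 0 ?_)).zmul _).smul _).add
    (((h _ ?_ ?_ ?_ ?_ ?_).rmul (signOp_conjugates_even (-1) ?_)).smul _)
  all_goals first
    | (intro n
       have hn := hn n
       have hg : qnum ℏ ((n : ℕ) * (α + 1)) ≠ 0 := by rw [mul_comm]; exact hgen n n.pos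
       simp only [Exponent.add_coef, Exponent.sub_coef, Exponent.neg_coef, fld_coef_pos,
         fld_coef_neg,
         plus_coef_pos, plus_coef_neg, minus_coef_pos, minus_coef_neg, reduceCtorEq, if_true,
         if_false, abs_neg, Nat.abs_cast, Int.cast_neg, Int.cast_natCast, add_zero, zero_add,
         sub_zero,
         zero_sub, mul_zero, zero_mul, neg_zero, ratioAlpha_pos, ratioAlpha_neg]
       try field_simp
       try simp only [qnum_eq]
       try field_simp
       try simp only [qpow, mul_sub, sub_mul, mul_add, add_mul, neg_mul, mul_neg, ← Complex.exp_add]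
       try ring_nf
       done)
    | (simp [zeroSum_eq, zeroEig, sum_boson, zeroComm, field, AtildeStar, fld, plus, minus, single,
         ratioTwo, ratioAlpha]
       done)
    | (simp [zeroSum_eq, zeroEig, sum_boson, zeroComm, field, AtildeStar, fld, plus, minus, single,
         ratioTwo, ratioAlpha]
       field_simp
       ring)

theorem psiStar4Bare_Xm2 {ℏ α : ℂ} (hq : ∀ n : ℕ, 0 < n → qpow ℏ n ≠ 1) (hα' : α ≠ -1)
    (hgen : ∀ n : ℕ, 0 < n → qnum ℏ ((α + 1) * n) ≠ 0) :
    Exchange (psiStar4Bare ℏ α) (Xm2 ℏ α) (-1) := by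
  have hd := qdiff_ne_zero hq
  have hα : α + 1 ≠ 0 := fun h => hα' (eq_neg_of_add_eq_zero_left h)
  have hn : ∀ n : ℕ+, qnum ℏ (n : ℕ) ≠ 0 := fun n => qnum_natCast_ne_zero hq n n.pos
  unfold psiStar4Bare Xm2
  have h F l := (shape_psiStar4 ℏ α).exchange hq (k := α) (F := F) l
  -- The ratio q^l is q^{α+2} for the term with a²_+ and q^{-3α} for those with a²_-; each can be
  -- read off from the order of factors in which a²_± does not contribute.
  refine ((((((Exchange.sub (h _ (α + 2) ?_ ?_ ?_ ?_ ?_) (h _ (-(3 * α)) ?_ ?_ ?_ ?_ ?_)).rmul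
    (signOpInv_conjugates_even (-1) ?_)).smul _).sub
    (Exchange.sub (h _ (-(3 * α)) ?_ ?_ ?_ ?_ ?_) (h _ (-(3 * α)) ?_ ?_ ?_ ?_ ?_))).zmul _).smul _)
  all_goals first
    | (intro n
       have hn := hn n
       have hg : qnum ℏ ((n : ℕ) * (α + 1)) ≠ 0 := by rw [mul_comm]; exact hgen n n.pos
       simp only [Exponent.add_coef, Exponent.sub_coef, Exponent.neg_coef, fld_coef_pos,
         fld_coef_neg,
         plus_coef_pos, plus_coef_neg, minus_coef_pos, minus_coef_neg, reduceCtorEq, if_true,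
         if_false, abs_neg, Nat.abs_cast, Int.cast_neg, Int.cast_natCast, add_zero, zero_add,
         sub_zero,
         zero_sub, mul_zero, zero_mul, neg_zero, ratioAlpha_pos, ratioAlpha_neg]
       try field_simp
       try simp only [qnum_eq]
       try field_simp
       try simp only [qpow, mul_sub, sub_mul, mul_add, add_mul, neg_mul, mul_neg, ← Complex.exp_add]
       try ring_nf
       done)
    | (simp [zeroSum_eq, zeroEig, sum_boson, zeroComm, field, AtildeStar, fld, plus, minus, single,
         ratioTwo, ratioAlpha]
       done)
    | (simp [zeroSum_eq, zeroEig, sum_boson, zeroComm, field, AtildeStar, fld, plus, minus, single,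
         ratioTwo, ratioAlpha]
       field_simp
       ring)

/-! ### Commutation of `φ₄` and `φ*₁` with the raising currents -/

/-- An exponent whose oscillators enter only through D pairs with nothing but a². -/
theorem Shape.comm_of_coef_eq_zero {ℏ k : ℂ} (hq : ∀ n : ℕ, 0 < n → qpow ℏ n ≠ 1) {E F : Exponent}
    {x : ℤ → ℂ} (h : Shape ℏ E x 0 0) (ha : ∀ n ≠ 0, F.coef a2 n = 0)
    (hE : zeroSum k E.zlog F.charge = 0) (hF : zeroSum k F.zlog E.charge = 0)
    (hc : zeroSum k E.zconst F.charge = zeroSum k F.zconst E.charge) :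
    Exchange (normalExp ℏ k E) (normalExp ℏ k F) 1 :=
  h.comm hq (fun n => by rw [ha _ (by have := n.ne_zero; omega)]; simp)
    (fun n => by rw [ha _ (by have := n.ne_zero; omega)]; simp) hE hF hc

theorem Shape.exchange_Xp1 {ℏ k : ℂ} (hq : ∀ n : ℕ, 0 < n → qpow ℏ n ≠ 1) {E : Exponent}
    {x : ℤ → ℂ} (h : Shape ℏ E x 0 0) (hl : ∀ i, i ≠ a1 → i ≠ a2 → E.zlog i = 0)
    (hz : ∀ i, i ≠ a1 → i ≠ a2 → E.zconst i = 0) (hc : ∀ i, i ≠ a1 → i ≠ a2 → E.charge i = 0) :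
    Exchange (normalExp ℏ k E) (Xp1 ℏ k) 1 := by
  unfold Xp1
  refine (((Exchange.sub (h.comm_of_coef_eq_zero hq ?_ ?_ ?_ ?_)
    (h.comm_of_coef_eq_zero hq ?_ ?_ ?_ ?_)).rmul (signOp_conjugates_even 0 ?_)).zmul _).smul _
  all_goals simp [zeroSum_eq, zeroEig, sum_boson, zeroComm, fld, field, single, hl, hz, hc]

theorem Shape.exchange_Xp2 {ℏ k : ℂ} (hq : ∀ n : ℕ, 0 < n → qpow ℏ n ≠ 1) {E : Exponent}
    {x : ℤ → ℂ} (h : Shape ℏ E x 0 0) (hl : ∀ i, i ≠ a1 → i ≠ a2 → E.zlog i = 0)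
    (hz : ∀ i, i ≠ a1 → i ≠ a2 → E.zconst i = 0) (hc : ∀ i, i ≠ a1 → i ≠ a2 → E.charge i = 0) :
    Exchange (normalExp ℏ k E) (Xp2 ℏ k) 1 := by
  unfold Xp2
  refine ((h.comm_of_coef_eq_zero hq ?_ ?_ ?_ ?_).rmul (signOp_conjugates_even 0 ?_)).neg.add
    (h.comm_of_coef_eq_zero hq ?_ ?_ ?_ ?_)
  all_goals simp [zeroSum_eq, zeroEig, sum_boson, zeroComm, fld, field, plus, single, hl, hz, hc]

theorem Exchange.commute {F G : Series} (h : Exchange F G 1) : Commute₂ F G := fun s t => by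
  rw [h, one_smul]

theorem Exchange.anticommute {F G : Series} (h : Exchange F G (-1)) : Anticommute₂ F G :=
  fun s t => (h s t).trans (neg_one_smul ℂ (G t * F s))

/-! ### Relations with the Cartan generators -/

/-- The coefficients of `h¹_m`, `M = |m|`. -/
def h1Coef (ℏ k M : ℂ) : Boson → ℂ
  | a1 => qpow ℏ (-M / 2)
  | a2 => 0
  | b12 => qpow ℏ (-(k / 2 + 1) * M) * (qpow ℏ M + qpow ℏ (-M))
  | b13 => qpow ℏ (-(k / 2 + 2) * M)
  | b23 => -qpow ℏ (-(k / 2 + 1) * M)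
  | c => 0

/-- The coefficients of `h²_m`, `M = |m|`. -/
def h2Coef (ℏ k M : ℂ) : Boson → ℂ
  | a1 => 0
  | a2 => qpow ℏ (-M / 2)
  | b12 => -qpow ℏ (-(k / 2 + 1) * M)
  | b13 => -qpow ℏ (-(k / 2 + 1) * M)
  | b23 => 0
  | c => 0

theorem end_sub_eq_add_neg_smul (R S : Module.End ℂ Fock) (a : ℂ) :
    R - a • S = R + (-a) • S := by
  exact (sub_eq_add_neg R (a • S)).trans (congrArg (R + ·) (neg_smul a S).symm)

theorem h1_eq (ℏ k : ℂ) (m : ℤ) : h1 ℏ k m = ∑ i, h1Coef ℏ k (|m| : ℤ) i • osc ℏ k i m := by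
  simp only [h1, sum_boson, h1Coef, zero_smul, end_sub_eq_add_neg_smul]
  abel

theorem h2_eq (ℏ k : ℂ) (m : ℤ) : h2 ℏ k m = ∑ i, h2Coef ℏ k (|m| : ℤ) i • osc ℏ k i m := by
  simp only [h2, sum_boson, h2Coef, zero_smul, end_sub_eq_add_neg_smul]
  abel

theorem normalExp_conj_diagOp {ℏ k κ : ℂ} {f g : Charge → ℂ} {E : Exponent}
    (hfg : ∀ μ, f μ * g μ = 1) (h : ∀ μ, f (μ + E.charge) = κ * f μ) (s : ℂ) :
    diagOp f * normalExp ℏ k E s * diagOp g = κ • normalExp ℏ k E s := by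
  have hone : diagOp f * diagOp g = 1 := by
    rw [diagOp_mul, show f * g = 1 from funext hfg, diagOp_one]
  rw [diagOp_conjugates h, smul_mul_assoc, mul_assoc, hone, mul_one]

/-- A Cartan mode is one more linear combination of oscillators, so the same pairing applies;
positive modes see the coefficients of `E` at `-n`, negative modes those at `n`. In h¹ the b²³
coefficient is -qⁿ times the b¹³ one, whence the conditions `h1p` and `h1n`. -/
theorem Shape.cartanRelations {ℏ k w u v : ℂ} (hq : ∀ n : ℕ, 0 < n → qpow ℏ n ≠ 1)
    {E : Exponent} {x y z : ℤ → ℂ} (h : Shape ℏ E x y z)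
    (hw1 : zeroEig k a1 E.charge + 2 * zeroEig k b12 E.charge + zeroEig k b13 E.charge
      - zeroEig k b23 E.charge = 0)
    (hw2 : zeroEig k a2 E.charge - zeroEig k b12 E.charge - zeroEig k b13 E.charge = w)
    (h1p : ∀ n : ℕ+, y (-n) = z (-n) * qpow ℏ (n : ℕ))
    (h1n : ∀ n : ℕ+, y n = z n * qpow ℏ (n : ℕ))
    (h2p : ∀ n : ℕ+, y (-n) * qpow ℏ (-(k / 2 + 1) * (n : ℕ)) * qnum ℏ (n : ℕ)
      + x (-n) * qpow ℏ (-(n : ℕ) / 2) * qnum ℏ ((k + 1) * (n : ℕ))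
      = qpow ℏ (u * (n : ℕ)) * qnum ℏ (w * (n : ℕ)))
    (h2n : ∀ n : ℕ+, y n * qpow ℏ (-(k / 2 + 1) * (n : ℕ)) * qnum ℏ (n : ℕ)
      + x n * qpow ℏ (-(n : ℕ) / 2) * qnum ℏ ((k + 1) * (n : ℕ))
      = qpow ℏ (v * (n : ℕ)) * qnum ℏ (w * (n : ℕ))) :
    CartanRelations ℏ k w u v (normalExp ℏ k E) where
  weight_one s := by
    have := normalExp_conj_diagOp (ℏ := ℏ) (k := k) (κ := 1) (E := E) (s := s)
      (f := fun μ => qpow ℏ (1 * (zeroEig k a1 μ + 2 * zeroEig k b12 μ + zeroEig k b13 μ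
        - zeroEig k b23 μ)))
      (g := fun μ => qpow ℏ (-1 * (zeroEig k a1 μ + 2 * zeroEig k b12 μ + zeroEig k b13 μ
        - zeroEig k b23 μ)))
      (fun μ => by rw [← qpow_add, ← add_mul, add_neg_cancel, zero_mul, qpow_zero])
      (fun μ => by
        simp only [zeroEig_add]
        rw [one_mul (qpow ℏ _)]
        congr 1
        linear_combination hw1)
    rwa [one_smul] at this
  weight_two s := normalExp_conj_diagOp
      (fun μ => by rw [← qpow_add, ← add_mul, add_neg_cancel, zero_mul, qpow_zero])
      (fun μ => by
        simp only [zeroEig_add]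
        rw [← qpow_add]
        congr 1
        linear_combination hw2) s
  h1_pos n hn s := by
    lift n to ℕ+ using hn
    rw [h1_eq, sum_osc_pos_normalExp, h.pairing_neg (qnum_natCast_ne_zero hq n n.pos), h1p]
    simp only [h1Coef, Nat.abs_cast, Int.cast_natCast]
    rw [show -(k / 2 + 1) * ((n : ℕ) : ℂ) = (n : ℕ) + -(k / 2 + 2) * (n : ℕ) by ring, qpow_add]
    convert zero_smul ℂ _
    ring
  h1_neg n hn s := by
    lift n to ℕ+ using hn
    rw [h1_eq, sum_osc_neg_normalExp, h.pairing_pos (qnum_natCast_ne_zero hq n n.pos), h1n]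
    simp only [h1Coef, abs_neg, Nat.abs_cast, Int.cast_natCast]
    rw [show -(k / 2 + 1) * ((n : ℕ) : ℂ) = (n : ℕ) + -(k / 2 + 2) * (n : ℕ) by ring, qpow_add]
    convert zero_smul ℂ _
    ring
  h2_pos n hn s := by
    lift n to ℕ+ using hn
    rw [h2_eq, sum_osc_pos_normalExp, h.pairing_neg (qnum_natCast_ne_zero hq n n.pos), zmul,
      mul_div_assoc', ← h2p]
    simp only [h2Coef, Nat.abs_cast, Int.cast_natCast]
    congr 1
    ring
  h2_neg n hn s := by
    lift n to ℕ+ using hn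
    rw [h2_eq, sum_osc_neg_normalExp, h.pairing_pos (qnum_natCast_ne_zero hq n n.pos), zmul,
      mul_div_assoc', ← h2n, sub_neg_eq_add]
    simp only [h2Coef, abs_neg, Nat.abs_cast, Int.cast_natCast]
    congr 1
    ring

/-- Oscillators preserve the charge, hence commute with the diagonal sign operator. -/
theorem CartanRelations.rmul_signOp {ℏ k w u v : ℂ} {Θ : Series} (h : CartanRelations ℏ k w u v Θ)
    (L : Finset Boson) : CartanRelations ℏ k w u v (rmul Θ (signOp k L)) := by
  have h1c : ∀ m, Commute (h1 ℏ k m) (signOp k L) := fun m => by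
    rw [h1_eq]
    exact Commute.sum_left _ _ _ fun i _ => (osc_commute_signOp _ _ _ _ _).smul_left _
  have h2c : ∀ m, Commute (h2 ℏ k m) (signOp k L) := fun m => by
    rw [h2_eq]
    exact Commute.sum_left _ _ _ fun i _ => (osc_commute_signOp _ _ _ _ _).smul_left _
  have hr : ∀ {R : Module.End ℂ Fock} (S : Module.End ℂ Fock), Commute R (signOp k L) →
      R * (S * signOp k L) - S * signOp k L * R = (R * S - S * R) * signOp k L := fun S hR => by
    rw [end_sub_mul, mul_assoc S, ← hR.eq, mul_assoc, mul_assoc]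
  constructor
  · intro s
    rw [rmul, ← mul_assoc, mul_assoc,
      show signOp k L * qh1 ℏ k (-1) = qh1 ℏ k (-1) * signOp k L from diagOp_commute _ _,
      ← mul_assoc, h.weight_one]
  · intro s
    rw [rmul, ← mul_assoc, mul_assoc,
      show signOp k L * qh2 ℏ k (-1) = qh2 ℏ k (-1) * signOp k L from diagOp_commute _ _,
      ← mul_assoc, h.weight_two, smul_mul_assoc]
  · intro n hn s
    rw [rmul, hr _ (h1c _), h.h1_pos n hn, zero_mul]
  · intro n hn s
    rw [rmul, hr _ (h1c _), h.h1_neg n hn, zero_mul]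
  · intro n hn s
    rw [rmul, hr _ (h2c _), h.h2_pos n hn, smul_mul_assoc]
    rfl
  · intro n hn s
    rw [rmul, hr _ (h2c _), h.h2_neg n hn, smul_mul_assoc]
    rfl

/-! ### Weights and Cartan commutators of the four elementary operators -/

theorem cartanRelations_phi4 {ℏ α : ℂ} (hq : ∀ n : ℕ, 0 < n → qpow ℏ n ≠ 1) :
    CartanRelations ℏ α (-(α + 1)) (1 + 3 / 2 * α) (-(1 + 1 / 2 * α)) (phi4 ℏ α) := by
  have hd := qdiff_ne_zero hq
  refine (shape_phi4 ℏ α).cartanRelations hq ?_ ?_ (fun n => ?_) (fun n => ?_) (fun n => ?_)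
    (fun n => ?_)
  · simp [zeroEig, sum_boson, zeroComm, field, Astar]
    try ring
  · simp [zeroEig, sum_boson, zeroComm, field, Astar]
    try ring
  · simp
  · simp
  all_goals
    simp only [abs_neg, Nat.abs_cast, Int.cast_neg, Int.cast_natCast, Pi.zero_apply, qnum_eq]
    field_simp
    simp only [qpow, mul_sub, sub_mul, mul_add, add_mul, neg_mul, mul_neg, ← Complex.exp_add]
    ring_nf

theorem cartanRelations_phiStar1 {ℏ α : ℂ} (hq : ∀ n : ℕ, 0 < n → qpow ℏ n ≠ 1) (hα' : α ≠ -1)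
    (hgen : ∀ n : ℕ, 0 < n → qnum ℏ ((α + 1) * n) ≠ 0) :
    CartanRelations ℏ α α (3 / 2 * α) (-(1 / 2 * α)) (phiStar1 ℏ α) := by
  have hd := qdiff_ne_zero hq
  have hα : α + 1 ≠ 0 := fun h => hα' (eq_neg_of_add_eq_zero_left h)
  refine (shape_phiStar1 ℏ α).cartanRelations hq ?_ ?_ (fun n => ?_) (fun n => ?_) (fun n => ?_)
    (fun n => ?_)
  · simp [zeroEig, sum_boson, zeroComm, field, Bstar]
    field_simp
    ring
  · simp [zeroEig, sum_boson, zeroComm, field, Bstar]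
    field_simp
    try ring
  · simp
  · simp
  all_goals
    have hg : qnum ℏ ((n : ℕ) * (α + 1)) ≠ 0 := by rw [mul_comm]; exact hgen n n.pos
    simp only [abs_neg, Nat.abs_cast, Int.cast_neg, Int.cast_natCast, Pi.zero_apply,
      ratioAlpha_pos, ratioAlpha_neg]
    field_simp
    simp only [qnum_eq]
    field_simp
    simp only [qpow, mul_sub, sub_mul, mul_add, add_mul, neg_mul, mul_neg, ← Complex.exp_add]
    ring_nf

theorem cartanRelations_psi1Bare {ℏ α : ℂ} (hq : ∀ n : ℕ, 0 < n → qpow ℏ n ≠ 1) :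
    CartanRelations ℏ α (-α) (1 / 2 * α) (-(3 / 2 * α)) (psi1Bare ℏ α) := by
  have hd := qdiff_ne_zero hq
  refine (shape_psi1 ℏ α).cartanRelations hq ?_ ?_ (fun n => ?_) (fun n => ?_) (fun n => ?_)
    (fun n => ?_)
  · simp [zeroEig, sum_boson, zeroComm, field, BtildeStar]
    try ring
  · simp [zeroEig, sum_boson, zeroComm, field, BtildeStar]
    try ring
  all_goals
    simp only [abs_neg, Nat.abs_cast, Int.cast_neg, Int.cast_natCast, qnum_eq]
    try field_simp
    simp only [qpow, mul_sub, sub_mul, mul_add, add_mul, neg_mul, mul_neg, ← Complex.exp_add]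
    ring_nf

theorem cartanRelations_psiStar4Bare {ℏ α : ℂ} (hq : ∀ n : ℕ, 0 < n → qpow ℏ n ≠ 1) (hα' : α ≠ -1)
    (hgen : ∀ n : ℕ, 0 < n → qnum ℏ ((α + 1) * n) ≠ 0) :
    CartanRelations ℏ α (α + 1) (1 / 2 * α - 1) (-(3 / 2 * α) + 1) (psiStar4Bare ℏ α) := by
  have hd := qdiff_ne_zero hq
  have hα : α + 1 ≠ 0 := fun h => hα' (eq_neg_of_add_eq_zero_left h)
  refine (shape_psiStar4 ℏ α).cartanRelations hq ?_ ?_ (fun n => ?_) (fun n => ?_) (fun n => ?_)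
    (fun n => ?_)
  · simp [zeroEig, sum_boson, zeroComm, field, AtildeStar]
    field_simp
    ring
  · simp [zeroEig, sum_boson, zeroComm, field, AtildeStar]
    field_simp
    try ring
  all_goals
    have hg : qnum ℏ ((n : ℕ) * (α + 1)) ≠ 0 := by rw [mul_comm]; exact hgen n n.pos
    simp only [abs_neg, Nat.abs_cast, Int.cast_neg, Int.cast_natCast,
      ratioAlpha_pos, ratioAlpha_neg]
    try field_simp
    try simp only [qnum_eq]
    try field_simp
    simp only [qpow, mul_sub, sub_mul, mul_add, add_mul, neg_mul, mul_neg, ← Complex.exp_add]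
    ring_nf

/-! ### Commutation with the lowering currents -/

/-- In every term the charges of `b13` and `b23` add up to zero. -/
theorem signOp_conjugates_Xm1 (ℏ k : ℂ) : Conjugates (signOp k {b13, b23}) (Xm1 ℏ k) 1 := by
  unfold Xm1
  refine ((((Conjugates.sub (signOp_conjugates_even 0 ?_) (signOp_conjugates_even 0 ?_)).rmul
    (diagOp_commute _ _)).zmul _).smul _).add
    (((signOp_conjugates_even 0 ?_).rmul (diagOp_commute _ _)).smul _)
  all_goals simp [zeroEig, sum_boson, zeroComm, fld, field, plus, minus, single]

/-- Every exponential in X^{-,2} lowers b¹³_0 + b²³_0 by one, which costs e^{-√-1 π} = -1. -/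
theorem signOp_conjugates_Xm2 (ℏ k : ℂ) : Conjugates (signOp k {b13, b23}) (Xm2 ℏ k) (-1) := by
  unfold Xm2
  refine (((((Conjugates.sub (signOp_conjugates_odd (-1) ?_) (signOp_conjugates_odd (-1) ?_)).rmul
    (diagOp_commute _ _)).smul _).sub (Conjugates.sub (signOp_conjugates_odd (-1) ?_)
      (signOp_conjugates_odd (-1) ?_))).zmul _).smul _
  all_goals
    simp [zeroEig, sum_boson, zeroComm, fld, field, plus, minus, single]
    norm_num

theorem commute_rmul_signOp_Xm1 {ℏ k : ℂ} {F : Series} (h : Exchange F (Xm1 ℏ k) 1) :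
    Commute₂ (rmul F (signOp k {b13, b23})) (Xm1 ℏ k) := by
  have := h.rmul_left (signOp_conjugates_Xm1 ℏ k)
  rw [mul_one] at this
  exact this.commute

/-- The sign from moving the sign operator past the current cancels the one from the bare
exponential. -/
theorem commute_rmul_signOp_Xm2 {ℏ k : ℂ} {F : Series} (h : Exchange F (Xm2 ℏ k) (-1)) :
    Commute₂ (rmul F (signOp k {b13, b23})) (Xm2 ℏ k) := by
  have := h.rmul_left (signOp_conjugates_Xm2 ℏ k)
  rw [neg_mul_neg, mul_one] at this
  exact this.commute

theorem phi4_Xp {ℏ α : ℂ} (hq : ∀ n : ℕ, 0 < n → qpow ℏ n ≠ 1) :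
    Commute₂ (phi4 ℏ α) (Xp1 ℏ α) ∧ Commute₂ (phi4 ℏ α) (Xp2 ℏ α) := by
  refine ⟨((shape_phi4 ℏ α).exchange_Xp1 hq ?_ ?_ ?_).commute,
    ((shape_phi4 ℏ α).exchange_Xp2 hq ?_ ?_ ?_).commute⟩
  all_goals
    intro i
    cases i <;> simp [field, Astar]

theorem phiStar1_Xp {ℏ α : ℂ} (hq : ∀ n : ℕ, 0 < n → qpow ℏ n ≠ 1) :
    Commute₂ (phiStar1 ℏ α) (Xp1 ℏ α) ∧ Commute₂ (phiStar1 ℏ α) (Xp2 ℏ α) := by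
  refine ⟨((shape_phiStar1 ℏ α).exchange_Xp1 hq ?_ ?_ ?_).commute,
    ((shape_phiStar1 ℏ α).exchange_Xp2 hq ?_ ?_ ?_).commute⟩
  all_goals
    intro i
    cases i <;> simp [field, Bstar]

/-! ### The remaining components -/

/-- The contour integral is a single coefficient, and the recursion is triangular: each component is
an explicit expression in the preceding one. The other three families work the same way. -/
theorem existsUnique_phi (ℏ α ρ ρ' : ℂ) (F : Series) :
    ∃! Φ : Fin 4 → Series, Φ 3 = F ∧ PhiRecursion ℏ α ρ ρ' Φ := by
  let G₂ := (-ρ'⁻¹) • contourBracket (parity 3) 1 (qpow ℏ (-α - 1)) F (Xm2 ℏ α)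
  let G₁ := contourBracket (parity 2) 0 (qpow ℏ 1) G₂ (Xm1 ℏ α)
  let G₀ := (-ρ⁻¹) • contourBracket (parity 1) 1 (qpow ℏ (-α)) G₁ (Xm2 ℏ α)
  refine ⟨![G₀, G₁, G₂, F], ⟨rfl, rfl, rfl, rfl⟩, ?_⟩
  rintro Φ ⟨h, h₂, h₁, h₀⟩
  rw [h] at h₂
  rw [h₂] at h₁
  rw [h₁] at h₀
  funext i
  fin_cases i
  exacts [h₀, h₁, h₂, h]

theorem existsUnique_phiStar (ℏ α ρ ρ' : ℂ) (F : Series) :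
    ∃! Φ : Fin 4 → Series, Φ 0 = F ∧ PhiStarRecursion ℏ α ρ ρ' Φ := by
  let G₁ := (qpow ℏ (-α) / ρ) • contourBracket (parity 0) 1 (qpow ℏ α) F (Xm2 ℏ α)
  let G₂ := (-qpow ℏ (-1)) • contourBracket (parity 1) 0 (qpow ℏ 1) G₁ (Xm1 ℏ α)
  let G₃ := (-(qpow ℏ (-α - 1) / ρ')) •
    contourBracket (parity 2) 1 (qpow ℏ (α + 1)) G₂ (Xm2 ℏ α)
  refine ⟨![F, G₁, G₂, G₃], ⟨rfl, rfl, rfl, rfl⟩, ?_⟩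
  rintro Φ ⟨h, h₁, h₂, h₃⟩
  rw [h] at h₁
  rw [h₁] at h₂
  rw [h₂] at h₃
  funext i
  fin_cases i
  exacts [h, h₁, h₂, h₃]

theorem existsUnique_psi (ℏ α ρ ρ' : ℂ) (F : Series) :
    ∃! Ψ : Fin 4 → Series, Ψ 0 = F ∧ PsiRecursion ℏ α ρ ρ' Ψ := by
  let G₁ := ρ⁻¹ • contourBracket (parity 0) 1 (qpow ℏ α) F (Xp2 ℏ α)
  let G₂ := contourBracket (parity 1) 0 (qpow ℏ 1) G₁ (Xp1 ℏ α)
  let G₃ := ρ'⁻¹ • contourBracket (parity 2) 1 (qpow ℏ (α + 1)) G₂ (Xp2 ℏ α)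
  refine ⟨![F, G₁, G₂, G₃], ⟨rfl, rfl, rfl, rfl⟩, ?_⟩
  rintro Ψ ⟨h, h₁, h₂, h₃⟩
  rw [h] at h₁
  rw [h₁] at h₂
  rw [h₂] at h₃
  funext i
  fin_cases i
  exacts [h, h₁, h₂, h₃]

theorem existsUnique_psiStar (ℏ α ρ ρ' : ℂ) (F : Series) :
    ∃! Ψ : Fin 4 → Series, Ψ 3 = F ∧ PsiStarRecursion ℏ α ρ ρ' Ψ := by
  let G₂ := (-(qpow ℏ (α + 1) / ρ')) •
    contourBracket (parity 3) 1 (qpow ℏ (-α - 1)) F (Xp2 ℏ α)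
  let G₁ := (-qpow ℏ 1) • contourBracket (parity 2) 0 (qpow ℏ 1) G₂ (Xp1 ℏ α)
  let G₀ := (qpow ℏ α / ρ) • contourBracket (parity 1) 1 (qpow ℏ (-α)) G₁ (Xp2 ℏ α)
  refine ⟨![G₀, G₁, G₂, F], ⟨rfl, rfl, rfl, rfl⟩, ?_⟩
  rintro Ψ ⟨h, h₂, h₁, h₀⟩
  rw [h] at h₂
  rw [h₂] at h₁
  rw [h₁] at h₀
  funext i
  fin_cases i
  exacts [h₀, h₁, h₂, h]

end QVertex

end
open QVertex in
theorem theorem2 (ℏ α ρ ρ' : ℂ)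
    (hq : ∀ n : ℕ, 0 < n → qpow ℏ n ≠ 1)
    (hα : α ≠ 0) (hα' : α ≠ -1)
    (hgen : ∀ n : ℕ, 0 < n → qnum ℏ ((α + 1) * n) ≠ 0)
    (hρ : ρ ^ 2 = qnum ℏ α) (hρ' : ρ' ^ 2 = qnum ℏ (α + 1))
    (hρ0 : ρ ≠ 0) :
    -- the relations characterizing `Φ₄`, `Φ*₁`, `Ψ₁`, `Ψ*₄`
    (Commute₂ (phi4 ℏ α) (Xp1 ℏ α) ∧ Commute₂ (phi4 ℏ α) (Xp2 ℏ α) ∧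
      CartanRelations ℏ α (-(α + 1)) (1 + 3 / 2 * α) (-(1 + 1 / 2 * α)) (phi4 ℏ α)) ∧
    (Commute₂ (phiStar1 ℏ α) (Xp1 ℏ α) ∧ Commute₂ (phiStar1 ℏ α) (Xp2 ℏ α) ∧
      CartanRelations ℏ α α (3 / 2 * α) (-(1 / 2 * α)) (phiStar1 ℏ α)) ∧
    (Commute₂ (psi1 ℏ α) (Xm1 ℏ α) ∧ Commute₂ (psi1 ℏ α) (Xm2 ℏ α) ∧
      CartanRelations ℏ α (-α) (1 / 2 * α) (-(3 / 2 * α)) (psi1 ℏ α)) ∧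
    (Commute₂ (psiStar4 ℏ α) (Xm1 ℏ α) ∧ Commute₂ (psiStar4 ℏ α) (Xm2 ℏ α) ∧
      CartanRelations ℏ α (α + 1) (1 / 2 * α - 1) (-(3 / 2 * α) + 1) (psiStar4 ℏ α)) ∧
    -- the remaining components, by contour integrals of the Drinfeld currents
    (∃! Φ : Fin 4 → Series, Φ 3 = phi4 ℏ α ∧ PhiRecursion ℏ α ρ ρ' Φ) ∧
    (∃! Φ : Fin 4 → Series, Φ 0 = phiStar1 ℏ α ∧ PhiStarRecursion ℏ α ρ ρ' Φ) ∧
    (∃! Ψ : Fin 4 → Series, Ψ 0 = psi1 ℏ α ∧ PsiRecursion ℏ α ρ ρ' Ψ) ∧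
    (∃! Ψ : Fin 4 → Series, Ψ 3 = psiStar4 ℏ α ∧ PsiStarRecursion ℏ α ρ ρ' Ψ) ∧
    -- the exponential in `ψ₁` without its sign factor
    (Commute₂ (psi1Bare ℏ α) (Xm1 ℏ α) ∧ Anticommute₂ (psi1Bare ℏ α) (Xm2 ℏ α) ∧
      CartanRelations ℏ α (-α) (1 / 2 * α) (-(3 / 2 * α)) (psi1Bare ℏ α)) := by
  exact
    ⟨⟨(phi4_Xp hq).1, (phi4_Xp hq).2, cartanRelations_phi4 hq⟩,
      ⟨(phiStar1_Xp hq).1, (phiStar1_Xp hq).2, cartanRelations_phiStar1 hq hα' hgen⟩,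
      ⟨commute_rmul_signOp_Xm1 (psi1Bare_Xm1 hq hα'), commute_rmul_signOp_Xm2 (psi1Bare_Xm2 hq hα'),
        (cartanRelations_psi1Bare hq).rmul_signOp _⟩,
      ⟨commute_rmul_signOp_Xm1 (psiStar4Bare_Xm1 hq hα' hgen),
        commute_rmul_signOp_Xm2 (psiStar4Bare_Xm2 hq hα' hgen),
        (cartanRelations_psiStar4Bare hq hα' hgen).rmul_signOp _⟩,
      existsUnique_phi ℏ α ρ ρ' _, existsUnique_phiStar ℏ α ρ ρ' _, existsUnique_psi ℏ α ρ ρ' _,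
      existsUnique_psiStar ℏ α ρ ρ' _,
      ⟨(psi1Bare_Xm1 hq hα').commute, (psi1Bare_Xm2 hq hα').anticommute,
        cartanRelations_psi1Bare hq⟩⟩
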